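/- Let $\varphi(x)=\sqrt{1-x^2}$, let $\|\cdot\|_p$ be the norm of $L_p[-1,1]$, $1\le p\le\infty$, and let $$E_n(f)_p=\inf\{\|f-P\|_p : P \text{ an algebraic polynomial of degree } <n\}.$$ For $r\ge 1$ let $\mathbb B_p^r$ be the set of functions $f$ that are $r-1$ times differentiable on $(-1,1)$, with $f^{(r-1)}$ locally absolutely continuous on $(-1,1)$ and $\|f^{(r)}\varphi^r\|_p<\infty$; let $\mathbb B_p^0=L_p[-1,1]$. For $k\in\mathbb N=\{1,2,\dots\}$, $r\in\mathbb N_0$ and $f\in\mathbb B_p^r$ put $$\omega_{k,r}^{\varphi}(f^{(r)},t)_p=\sup_{0\le h\le t}\bigl\|\mathcal W_{kh}^{\,r}(\cdot)\,\Delta^k_{h\varphi(\cdot)}(f^{(r)},\cdot)\bigr\|_p,\qquad \mathcal W_\delta(x)=\bigl((1-x-\delta\varphi(x)/2)(1+x-\delta\varphi(x)/2)\bigr)^{1/2},$$ where $\Delta_h^k(F,x)=\sum_{i=0}^k\binom ki(-1)^{k-i}F(x+(i-k/2)h)$ if $x\pm kh/2\in[-1,1]$, and $\Delta_h^k(F,x)=0$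 otherwise. **Theorem.** Let $1\le p\le\infty$, $k\in\mathbb N$, $r\in\mathbb N_0$. There are a constant $c$, depending only on $k,r,p$, and constants $c(N)$, depending only on $N,k,r,p$, such that the following holds. Let $N\in\mathbb N$, let $\phi:[0,1]\to[0,\infty)$ be nondecreasing with $\phi(0+)=0$ and $$\int_0^1\frac{r\phi(u)}{u^{r+1}}\,du<\infty$$ (no condition if $r=0$), and let $f\in L_p[-1,1]$ satisfy $E_n(f)_p\le\phi(1/n)$ for all $n\ge N$. Then $f$ agrees almost everywhere on $[-1,1]$ with a function belonging to $\mathbb B_p^r$ (so that, if $r\ge1$, this representative, again denoted by $f$, has a locally absolutely continuous derivative $f^{(r-1)}$ on $(-1,1)$), and for all $t\in[0,1/2]$ $$\omega_{k,r}^{\varphi}(f^{(r)},t)_p\le c\int_0^t\frac{r\phi(u)}{u^{r+1}}\,du+c\,t^k\int_t^1\frac{\phi(u)}{u^{k+r+1}}\,du+c(N)\,t^kE_{k+r}(f)_p .$$ If, in addition, $N\le k+r$ and $k+r\ge2$, then for all $t\in[0,1/2]$ $$\omega_{k,r}^{\varphi}(f^{(r)},t)_p\le c\int_0^t\frac{r\phi(u)}{u^{r+1}}\,du+c\,t^k\int_t^1\frac{\phi(u)}{u^{k+r+1}}\,du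 .$$ (At $t=0$ the products $t^k\int_t^1$ are read as $0$.) -/

import Mathlib

open MeasureTheory Set Filter Topology
open scoped ENNReal NNReal

noncomputable section

namespace InverseApprox

/-- Lebesgue measure on `[-1, 1]`. -/
def mu : Measure ℝ := volume.restrict (Icc (-1) 1)

/-- The weight `φ(x) = √(1 - x²)`. -/
def wphi (x : ℝ) : ℝ := Real.sqrt (1 - x ^ 2)

open Classical in
/-- The `k`-th symmetric difference `Δ_h^k(F, x)` relative to `[-1, 1]`: it is set to `0`
unless both `x - k h / 2` and `x + k h / 2` lie in `[-1, 1]`. -/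
def symDiff (k : ℕ) (h : ℝ) (F : ℝ → ℝ) (x : ℝ) : ℝ :=
  if x - k * h / 2 ∈ Icc (-1 : ℝ) 1 ∧ x + k * h / 2 ∈ Icc (-1 : ℝ) 1 then
    ∑ i ∈ Finset.range (k + 1),
      (k.choose i : ℝ) * (-1) ^ (k - i) * F (x + ((i : ℝ) - k / 2) * h)
  else 0

/-- The weight `𝒲_δ(x) = ((1 - x - δ φ(x) / 2) (1 + x - δ φ(x) / 2))^{1/2}`. -/
def wt (δ x : ℝ) : ℝ :=
  Real.sqrt ((1 - x - δ * wphi x / 2) * (1 + x - δ * wphi x / 2))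

/-- The modulus of smoothness `ω_{k,r}^φ(F, t)_p`; in the theorem `F` is an `r`-th derivative.
It takes values in `[0, ∞]`. -/
def modulus (k r : ℕ) (p : ℝ≥0∞) (F : ℝ → ℝ) (t : ℝ) : ℝ≥0∞ :=
  ⨆ h ∈ Icc (0 : ℝ) t,
    eLpNorm (fun x => wt (k * h) x ^ r * symDiff k (h * wphi x) F x) p mu

/-- `AC_loc(-1, 1)`: absolutely continuous on every compact subinterval of `(-1, 1)`. -/
def LocAC (F : ℝ → ℝ) : Prop :=
  ∀ a b : ℝ, -1 < a → a ≤ b → b < 1 → AbsolutelyContinuousOnInterval F a b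

/-- The class `𝔹_p^r`: for `r = 0` it is `L_p[-1, 1]`; for `r ≥ 1` it consists of the functions
which are `r - 1` times continuously differentiable in `(-1, 1)`, whose derivative of order
`r - 1` is locally absolutely continuous there, and with `f^{(r)} φ^r` in `L_p[-1, 1]`.
(The derivative `f^{(r)}` exists almost everywhere; where it does not, `iteratedDeriv` is `0`.) -/
def MemB (p : ℝ≥0∞) : ℕ → (ℝ → ℝ) → Prop
  | 0, f => MemLp f p mu
  | s + 1, f => ContDiffOn ℝ s f (Ioo (-1) 1) ∧ LocAC (iteratedDeriv s f) ∧
      MemLp (fun x => iteratedDeriv (s + 1) f x * wphi x ^ (s + 1)) p mu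

/-- `E_n(f)_p`: the degree of best approximation of `f` in `L_p[-1, 1]` by algebraic
polynomials of degree `< n`. -/
def bestApprox (n : ℕ) (p : ℝ≥0∞) (f : ℝ → ℝ) : ℝ≥0∞ :=
  ⨅ P ∈ Polynomial.degreeLT ℝ n, eLpNorm (fun x => f x - P.eval x) p mu

/-- The set `Φ` of nondecreasing `ϕ : [0, 1] → [0, ∞)` with `ϕ(0+) = 0`. Only the values on
`[0, 1]` matter. -/
structure IsPhi (ϕ : ℝ → ℝ) : Prop where
  mono : MonotoneOn ϕ (Icc 0 1)
  nonneg : ∀ u ∈ Icc (0 : ℝ) 1, 0 ≤ ϕ u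
  tendsto_zero : Tendsto ϕ (𝓝[>] 0) (𝓝 0)

/-- `∫_a^b m ϕ(u) / u^{s+1} du` in `[0, ∞]` (nonnegative integrand, `0 ≤ a ≤ b ≤ 1`). -/
def phiInt (ϕ : ℝ → ℝ) (m : ℝ) (s : ℕ) (a b : ℝ) : ℝ≥0∞ :=
  ∫⁻ u in Ioc a b, ENNReal.ofReal (m * ϕ u / u ^ (s + 1))

end InverseApprox

end

/-!
# An inverse theorem for polynomial approximation with derivatives in a weighted modulus

Let `P_j` be polynomials of degree `< 2^j` with `‖f - P_j‖_p ≤ 2 E_{2^j}(f)_p`, so that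
`‖P_{j+1} - P_j‖_p ≤ 4 ϕ(2^{-j})` as soon as `2^j ≥ N`. Everything rests on two estimates for a
polynomial `Q` of degree at most `n`, valid for all `1 ≤ p ≤ ∞`:

* Bernstein's inequality `‖φ^j Q^{(j)} / j!‖_p ≤ 24 (4n)^j ‖Q‖_p` (`bernstein`);
* `‖𝒲_{kh}^r Δ^k_{hφ}(Q^{(r)})‖_p ≤ c h^k n^{k+r} ‖Q‖_p` (`eLpNorm_symDiff_polynomial_le`).

For Bernstein's inequality put `x = cos θ`. Cauchy's formula on the image of the circle
`|u| = r = n / (n + 1)` under the Joukowski map `u ↦ (u + u⁻¹) / 2` bounds `φ^j Q^{(j)} / j!` by an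
integral of `|Q|` over that ellipse, and the Poisson formula for the polynomial
`u^n Q((u + u⁻¹) / 2)` bounds `|Q|` on the ellipse by an integral of `|Q|` over `[-1, 1]`. Both are
integral operators for the measures `|1 - u²| |dτ|` on the circles `u = r e^{iτ}` and `u = e^{iτ}`;
on the unit circle this measure is carried by `cos` to four times Lebesgue measure on `[-1, 1]`. For
the second operator the Poisson formula is applied to the function multiplied by a factor vanishing
at `±1`. The kernels have bounded row and column integrals, so Schur's test gives all `L_p` bounds
at once (`eLpNorm_hasseDeriv_cos_le`).

For differences, the maps `x ↦ x + a φ(x)` with `|a| ≤ kh / 2` contract distances by at most a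
factor `2` on the set where the difference lives, and `𝒲_{kh}(x) ≤ φ(x + a φ(x))`. Hence
`‖𝒲_{kh}^r Δ^k_{hφ} F‖_p ≤ 2^{k+1} ‖F φ^r‖_p` for every `F` (`eLpNorm_wt_mul_symDiff_le`). With
Bernstein's inequality this is the second estimate when `h n` is not small; when it is small, one
expands `Q^{(r)}` at `x`, where the Taylor terms of order `< k` disappear from the difference.

Suppose `r ≥ 1`. Since `∑ 2^{jr} ϕ(2^{-j})`, `j ≥ 1`, is at most a multiple of
`∫ ϕ(u) / u^{r+1} du`, which is finite, the norms `‖φ^i (P_{j+1} - P_j)^{(i)}‖_p`, `i ≤ r`, are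
summable by Bernstein's inequality. By a Sobolev inequality the derivatives of order `< r` converge
locally uniformly in `(-1, 1)`; the limit of the `P_j` is the required representative of `f`
(`exists_memB_of_summable`).

To bound the modulus at `t`, take `2^{-J}` comparable with `t` and write the `r`-th derivative `F`
as `(F - P_M^{(r)}) + ∑_{m ≤ j < M} (P_{j+1} - P_j)^{(r)} + (P_m - R)^{(r)} + R^{(r)}`, where
`M = max m (J + 2)` and `R` is near-best of degree `< k + r`, so that the `k`-th difference of
`R^{(r)}` is zero (`diffNorm_le_telescope`). The first term yields `∫_0^t`, the sum yields
`t^k ∫_t^1`, and `P_m - R` yields `t^k E_{k+r}(f)` with a constant depending on `m = max N (k + r)`.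
If `N ≤ k + r` and `k + r ≥ 2`, then `m = k + r` and `E_{k+r}(f) ≤ ϕ(1/2)`, which is at most a
constant multiple of `∫_{1/2}^1 ϕ(u) / u^{k+r+1} du`.
-/

noncomputable section

namespace InverseApprox

/-! ### Schur's test -/

/-- **Schur's test** for all exponents `1 ≤ p ≤ ∞` at once: if the integrals of `K` in each variable
are at most `A`, then the operator with kernel `K` is bounded by `A` from `L_p(ν)` to `L_p(μ)`. -/
theorem eLpNorm_lintegral_kernel_le {α β : Type*} [MeasurableSpace α] [MeasurableSpace β]
    {μ : Measure α} {ν : Measure β} [SFinite μ] [SFinite ν] {K : α → β → ℝ≥0∞}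
    (hK : Measurable (Function.uncurry K)) {A : ℝ≥0∞}
    (hrow : ∀ x, ∫⁻ y, K x y ∂ν ≤ A) (hcol : ∀ y, ∫⁻ x, K x y ∂μ ≤ A)
    {g : β → ℝ≥0∞} (hg : Measurable g) {p : ℝ≥0∞} (hp : 1 ≤ p) :
    eLpNorm (fun x => ∫⁻ y, K x y * g y ∂ν) p μ ≤ A * eLpNorm g p ν := by
  by_cases hpt : p = ∞
  · subst hpt
    simp only [eLpNorm_exponent_top]
    have hKx : ∀ x, Measurable (K x) := fun x => hK.comp measurable_prodMk_left
    refine essSup_le_of_ae_le _ (Eventually.of_forall fun x => ?_)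
    calc ∫⁻ y, K x y * g y ∂ν ≤ ∫⁻ y, K x y * eLpNormEssSup g ν ∂ν := by
          refine lintegral_mono_ae ?_
          filter_upwards [enorm_ae_le_eLpNormEssSup g ν] with y hy
          gcongr
          simpa using hy
      _ = (∫⁻ y, K x y ∂ν) * eLpNormEssSup g ν := by
          rw [lintegral_mul_const _ (hKx x)]
      _ ≤ _ := mul_le_mul_left (hrow x) _
  · have hp0 : p ≠ 0 := (zero_lt_one.trans_le hp).ne'
    have hq1 : 1 ≤ p.toReal := by
      rw [← ENNReal.toReal_one]; exact ENNReal.toReal_mono hpt hp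
    set q := p.toReal with hq
    have hq0 : 0 < q := by linarith
    rw [eLpNorm_eq_lintegral_rpow_enorm_toReal hp0 hpt,
      eLpNorm_eq_lintegral_rpow_enorm_toReal hp0 hpt]
    simp only [enorm_eq_self, ← hq]
    have hKx : ∀ x, Measurable (K x) := fun x => hK.comp measurable_prodMk_left
    have key : ∀ x, (∫⁻ y, K x y * g y ∂ν) ^ q ≤ A ^ (q - 1) * ∫⁻ y, K x y * g y ^ q ∂ν := by
      intro x
      -- Hölder's inequality after writing `K g = (K g ^ q) ^ (1 / q) * K ^ (1 - 1 / q)`.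
      have h1 := ENNReal.lintegral_mul_norm_pow_le (μ := ν)
        (f := fun y => K x y * g y ^ q) (g := K x)
        ((hKx x).mul (hg.pow_const q)).aemeasurable (hKx x).aemeasurable
        (p := 1 / q) (q := 1 - 1 / q) (by positivity)
        (by rw [sub_nonneg, div_le_one hq0]; exact hq1) (by ring)
      have h2 : ∀ y, (K x y * g y ^ q) ^ (1 / q) * K x y ^ (1 - 1 / q) = K x y * g y := by
        intro y
        rw [ENNReal.mul_rpow_of_nonneg _ _ (by positivity), ← ENNReal.rpow_mul,
          mul_one_div_cancel hq0.ne', ENNReal.rpow_one, mul_right_comm,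
          ← ENNReal.rpow_add_of_nonneg _ _ (by positivity)
            (by rw [sub_nonneg, div_le_one hq0]; exact hq1)]
        simp
      simp only [h2] at h1
      calc (∫⁻ y, K x y * g y ∂ν) ^ q
          ≤ ((∫⁻ y, K x y * g y ^ q ∂ν) ^ (1 / q) * (∫⁻ y, K x y ∂ν) ^ (1 - 1 / q)) ^ q := by
            gcongr
        _ = (∫⁻ y, K x y ∂ν) ^ (q - 1) * (∫⁻ y, K x y * g y ^ q ∂ν) := by
            rw [ENNReal.mul_rpow_of_nonneg _ _ hq0.le, ← ENNReal.rpow_mul, ← ENNReal.rpow_mul,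
              one_div_mul_cancel hq0.ne', ENNReal.rpow_one, mul_comm]
            congr 2
            field_simp
        _ ≤ _ := by
            gcongr
            · exact hrow x
    calc (∫⁻ x, (∫⁻ y, K x y * g y ∂ν) ^ q ∂μ) ^ (1 / q)
        ≤ (∫⁻ x, A ^ (q - 1) * ∫⁻ y, K x y * g y ^ q ∂ν ∂μ) ^ (1 / q) := by
          gcongr with x
          exact key x
      _ = (A ^ (q - 1) * ∫⁻ y, (∫⁻ x, K x y ∂μ) * g y ^ q ∂ν) ^ (1 / q) := by
          have hm : Measurable (Function.uncurry fun x y => K x y * g y ^ q) :=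
            hK.mul ((hg.comp measurable_snd).pow_const q)
          have hKy : ∀ y, Measurable (fun x => K x y) := fun y => hK.comp measurable_prodMk_right
          have hm' : Measurable fun x => ∫⁻ y, K x y * g y ^ q ∂ν := hm.lintegral_prod_right'
          rw [lintegral_const_mul _ hm', lintegral_lintegral_swap hm.aemeasurable]
          congr 3
          ext y
          rw [lintegral_mul_const _ (hKy y)]
      _ ≤ (A ^ (q - 1) * ∫⁻ y, A * g y ^ q ∂ν) ^ (1 / q) := by
          gcongr with y
          exact hcol y
      _ = (A ^ q * ∫⁻ y, g y ^ q ∂ν) ^ (1 / q) := by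
          rw [lintegral_const_mul _ (hg.pow_const q), ← mul_assoc]
          congr 2
          conv_lhs => rw [← ENNReal.rpow_one A, ← ENNReal.rpow_mul, one_mul]
          rw [← ENNReal.rpow_add_of_nonneg _ _ (by linarith) (by norm_num)]
          congr 1; ring
      _ = A * (∫⁻ y, g y ^ q ∂ν) ^ (1 / q) := by
          rw [ENNReal.mul_rpow_of_nonneg _ _ (by positivity), ← ENNReal.rpow_mul,
            mul_one_div_cancel hq0.ne', ENNReal.rpow_one]

/-! ### The Joukowski map and Cauchy's formula -/

theorem circleMap_one_norm (θ : ℝ) : ‖circleMap 0 1 θ‖ = 1 := by simp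

/-- The Poisson kernel has mean `1`. -/
theorem lintegral_inv_norm_sq_sub {u : ℂ} (hu : ‖u‖ < 1) :
    ∫⁻ θ in Ioc 0 (2 * Real.pi), ENNReal.ofReal (1 / ‖circleMap 0 1 θ - u‖ ^ 2) =
      ENNReal.ofReal (2 * Real.pi / (1 - ‖u‖ ^ 2)) := by
  have h0 : 0 < 1 - ‖u‖ ^ 2 := by nlinarith [norm_nonneg u]
  have hne : ∀ θ, ‖circleMap 0 1 θ - u‖ ≠ 0 := by
    intro θ h
    rw [norm_eq_zero, sub_eq_zero] at h
    rw [← h] at hu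
    simp at hu
  have hP := DiffContOnCl.circleAverage_poissonKernel_smul' (f := fun _ : ℂ => (1 : ℂ)) (c := 0)
    (R := 1) (w := u) diffContOnCl_const (by simpa using hu)
  rw [Real.circleAverage_def] at hP
  simp only [sub_zero, norm_circleMap_zero, abs_one, one_pow, Complex.real_smul, mul_one] at hP
  rw [intervalIntegral.integral_ofReal] at hP
  norm_cast at hP
  have hcont : Continuous fun θ => 1 / ‖circleMap 0 1 θ - u‖ ^ 2 := by
    refine continuous_const.div (by fun_prop) fun θ => pow_ne_zero _ (hne θ)
  rw [← ofReal_integral_eq_lintegral_ofReal, ← intervalIntegral.integral_of_le Real.two_pi_pos.le]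
  · congr 1
    have : ∀ θ, (1 - ‖u‖ ^ 2) / ‖circleMap 0 1 θ - u‖ ^ 2
        = (1 - ‖u‖ ^ 2) * (1 / ‖circleMap 0 1 θ - u‖ ^ 2) := fun θ => by ring
    simp only [this, intervalIntegral.integral_const_mul] at hP
    have hpi := Real.pi_pos
    field_simp at hP ⊢
    linarith
  · exact (hcont.integrableOn_Icc).mono_set Ioc_subset_Icc_self
  · exact Eventually.of_forall fun θ => by positivity

/-- For `|v| = |a| = 1` one has `|r v - a| = |v - r a|`. -/
theorem norm_circleMap_sub_eq {r : ℝ} (τ : ℝ) {a : ℂ} (ha : ‖a‖ = 1) :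
    ‖circleMap 0 r τ - a‖ = ‖circleMap 0 1 τ - r * a‖ := by
  set v := circleMap 0 1 τ with hv
  have hv1 : ‖v‖ = 1 := by simp [hv]
  have hrv : circleMap 0 r τ = r * v := by simp [hv, circleMap]
  have hvv : v * (starRingEnd ℂ) v = 1 := by rw [Complex.mul_conj']; simp [hv1]
  have haa : a * (starRingEnd ℂ) a = 1 := by rw [Complex.mul_conj']; simp [ha]
  have : (r : ℂ) * v - a = -(v * a) * (starRingEnd ℂ) (v - r * a) := by
    rw [map_sub, map_mul, Complex.conj_ofReal]
    linear_combination (-r * v) * haa + a * hvv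
  rw [hrv, this, norm_mul, norm_neg, norm_mul, hv1, ha, RCLike.norm_conj]
  simp

theorem lintegral_inv_norm_sq_circleMap_sub {r : ℝ} (hr0 : 0 ≤ r) (hr : r < 1) {a : ℂ}
    (ha : ‖a‖ = 1) :
    ∫⁻ τ in Ioc 0 (2 * Real.pi), ENNReal.ofReal (1 / ‖circleMap 0 r τ - a‖ ^ 2) =
      ENNReal.ofReal (2 * Real.pi / (1 - r ^ 2)) := by
  simp only [norm_circleMap_sub_eq _ ha]
  have h : ‖(r : ℂ) * a‖ = r := by simp [ha, abs_of_nonneg hr0]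
  rw [lintegral_inv_norm_sq_sub (by rw [h]; exact hr), h]

/-- The Joukowski map `u ↦ (u + u⁻¹) / 2`. -/
def jou (u : ℂ) : ℂ := (u + u⁻¹) / 2

theorem jou_circleMap_one (θ : ℝ) : jou (circleMap 0 1 θ) = (Real.cos θ : ℂ) := by
  rw [jou, circleMap_zero_inv]
  simp only [circleMap_zero, inv_one, Complex.ofReal_one, one_mul, Complex.ofReal_neg,
    Complex.ofReal_cos, Complex.cos]

theorem hasDerivAt_jou {u : ℂ} (hu : u ≠ 0) : HasDerivAt jou ((1 - (u ^ 2)⁻¹) / 2) u := by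
  have := ((hasDerivAt_id u).add (hasDerivAt_inv hu)).div_const 2
  refine this.congr_deriv ?_
  ring

/-- The two preimages of `x = cos θ` under the Joukowski map are `a = e^{iθ}` and `b = e^{-iθ}`;
this factors `jou u - x` accordingly. -/
theorem jou_sub {u a b x : ℂ} (hu : u ≠ 0) (hab : a * b = 1) (hs : a + b = 2 * x) :
    jou u - x = (u - a) * (u - b) / (2 * u) := by
  unfold jou
  field_simp
  linear_combination u * hs - hab

/-- As `u` runs through the circle of radius `r < 1` counterclockwise, `jou u` goes once around `x`
clockwise; hence the minus sign. The factor `(1 - u⁻²) / 2` is the derivative of `jou`. -/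
theorem circleIntegral_jou_zpow {a b x : ℂ} (ha : ‖a‖ = 1) (hb : ‖b‖ = 1) (hab : a * b = 1)
    (hs : a + b = 2 * x) {r : ℝ} (hr0 : 0 < r) (hr : r < 1) (m : ℤ) :
    (∮ u in C(0, r), (jou u - x) ^ m * ((1 - (u ^ 2)⁻¹) / 2)) =
      if m = -1 then -(2 * Real.pi * Complex.I) else 0 := by
  have hsph : ∀ u ∈ Metric.sphere (0 : ℂ) r, u ≠ 0 ∧ u - a ≠ 0 ∧ u - b ≠ 0 := by
    intro u hu
    have hu' : ‖u‖ = r := by simpa using hu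
    refine ⟨fun h => ?_, fun h => ?_, fun h => ?_⟩
    · rw [h, norm_zero] at hu'; exact hr0.ne hu'
    · rw [sub_eq_zero] at h; rw [h, ha] at hu'; exact hr.ne' hu'
    · rw [sub_eq_zero] at h; rw [h, hb] at hu'; exact hr.ne' hu'
  have hout : ∀ c : ℂ, ‖c‖ = 1 → (∮ u in C(0, r), (u - c)⁻¹) = 0 := by
    intro c hc
    refine DiffContOnCl.circleIntegral_eq_zero hr0.le (DifferentiableOn.diffContOnCl ?_)
    intro u hu
    rw [closure_ball _ hr0.ne'] at hu
    refine DifferentiableAt.differentiableWithinAt ?_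
    refine (differentiableAt_id.sub_const c).inv ?_
    intro h
    simp only [id, sub_eq_zero] at h
    rw [h] at hu
    simp [hc] at hu
    linarith
  split_ifs with hm
  -- For `m = -1` the integrand is the logarithmic derivative of `(u - a) (u - b) / (2 u)`.
  · subst hm
    have h1 : EqOn (fun u => (jou u - x) ^ (-1 : ℤ) * ((1 - (u ^ 2)⁻¹) / 2))
        (fun u => ((u - a)⁻¹ + (u - b)⁻¹) - (u - 0)⁻¹) (Metric.sphere 0 r) := by
      intro u hu
      obtain ⟨h0, h1, h2⟩ := hsph u hu
      simp only
      rw [jou_sub h0 hab hs, zpow_neg_one, sub_zero]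
      field_simp
      linear_combination hab
    have hci : ∀ c : ℂ, ‖c‖ ≠ r → CircleIntegrable (fun u : ℂ => (u - c)⁻¹) 0 r := by
      intro c hc
      refine ContinuousOn.circleIntegrable hr0.le ?_
      refine ContinuousOn.inv₀ (by fun_prop) fun u hu h => hc ?_
      rw [sub_eq_zero] at h
      rw [← h]; simpa using hu
    rw [circleIntegral.integral_congr hr0.le h1, circleIntegral.integral_sub,
      circleIntegral.integral_add, hout a ha, hout b hb,
      circleIntegral.integral_sub_inv_of_mem_ball (by simpa using hr0)]
    · simp
    · exact hci a (by rw [ha]; exact hr.ne')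
    · exact hci b (by rw [hb]; exact hr.ne')
    · exact (hci a (by rw [ha]; exact hr.ne')).add (hci b (by rw [hb]; exact hr.ne'))
    · exact hci 0 (by rw [norm_zero]; exact hr0.ne)
  · have hm1 : ((m + 1 : ℤ) : ℂ) ≠ 0 := by
      exact_mod_cast fun h => hm (by omega)
    refine circleIntegral.integral_eq_zero_of_hasDerivWithinAt
      (f := fun u => (jou u - x) ^ (m + 1) / ((m + 1 : ℤ) : ℂ)) hr0.le fun u hu => ?_
    obtain ⟨h0, h1, h2⟩ := hsph u hu
    have hne : jou u - x ≠ 0 := by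
      rw [jou_sub h0 hab hs]
      exact div_ne_zero (mul_ne_zero h1 h2) (mul_ne_zero two_ne_zero h0)
    have hd := ((hasDerivAt_zpow (m + 1) (jou u - x) (Or.inl hne)).comp u
      ((hasDerivAt_jou h0).sub_const x)).div_const ((m + 1 : ℤ) : ℂ)
    refine (hd.congr_deriv ?_).hasDerivWithinAt
    rw [add_sub_cancel_right]
    field_simp

/-- The Taylor expansion at a real point of a real polynomial, evaluated at a complex one. -/
theorem eval_map_eq_sum_hasseDeriv (P : Polynomial ℝ) (x : ℝ) (w : ℂ) {n : ℕ}
    (hn : P.natDegree < n) :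
    (P.map Complex.ofRealHom).eval w =
      ∑ i ∈ Finset.range n, (((Polynomial.hasseDeriv i P).eval x : ℝ) : ℂ) * (w - x) ^ i := by
  have h1 : (P.map Complex.ofRealHom).eval w =
      ((Polynomial.taylor x P).map Complex.ofRealHom).eval (w - x) := by
    rw [Polynomial.map_taylor, Polynomial.taylor_eval]
    simp
  rw [h1, Polynomial.eval_eq_sum_range' (n := n)]
  · simp only [Polynomial.coeff_map, Polynomial.taylor_coeff]
    rfl
  · refine lt_of_le_of_lt Polynomial.natDegree_map_le ?_
    rwa [Polynomial.natDegree_taylor]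

/-- Cauchy's formula for `P^{(j)}(x) / j!`, pulled back to the circle `|u| = r` by the Joukowski
map. -/
theorem hasseDeriv_eval_eq_circleIntegral (P : Polynomial ℝ) (j : ℕ) {a b : ℂ} {x : ℝ}
    (ha : ‖a‖ = 1) (hb : ‖b‖ = 1) (hab : a * b = 1)
    (hs : a + b = 2 * x) {r : ℝ} (hr0 : 0 < r) (hr : r < 1) :
    -(2 * Real.pi * Complex.I) * (((Polynomial.hasseDeriv j P).eval x : ℝ) : ℂ) =
      ∮ u in C(0, r), (P.map Complex.ofRealHom).eval (jou u) *
        ((jou u - x) ^ (-(j + 1 : ℤ)) * ((1 - (u ^ 2)⁻¹) / 2)) := by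
  have hsph : ∀ u ∈ Metric.sphere (0 : ℂ) r, u ≠ 0 ∧ jou u - x ≠ 0 := by
    intro u hu
    have hu' : ‖u‖ = r := by simpa using hu
    have h0 : u ≠ 0 := fun h => by rw [h, norm_zero] at hu'; exact hr0.ne hu'
    refine ⟨h0, ?_⟩
    rw [jou_sub h0 hab hs]
    refine div_ne_zero (mul_ne_zero ?_ ?_) (mul_ne_zero two_ne_zero h0)
    · rw [sub_ne_zero]; rintro rfl; linarith
    · rw [sub_ne_zero]; rintro rfl; linarith
  set n := max P.natDegree j + 1 with hn
  have h1 : EqOn (fun u => (P.map Complex.ofRealHom).eval (jou u) *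
        ((jou u - x) ^ (-(j + 1 : ℤ)) * ((1 - (u ^ 2)⁻¹) / 2)))
      (fun u => ∑ i ∈ Finset.range n, (((Polynomial.hasseDeriv i P).eval x : ℝ) : ℂ) *
        ((jou u - x) ^ ((i : ℤ) - (j + 1)) * ((1 - (u ^ 2)⁻¹) / 2))) (Metric.sphere 0 r) := by
    intro u hu
    obtain ⟨h0, h2⟩ := hsph u hu
    simp only
    rw [eval_map_eq_sum_hasseDeriv P x (jou u) (n := n) (by omega), Finset.sum_mul]
    refine Finset.sum_congr rfl fun i _ => ?_
    rw [sub_eq_add_neg (i : ℤ), zpow_add₀ h2, zpow_natCast]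
    ring
  have hcont : ∀ m : ℤ, CircleIntegrable
      (fun u => (jou u - x) ^ m * ((1 - (u ^ 2)⁻¹) / 2)) 0 r := by
    intro m
    refine ContinuousOn.circleIntegrable hr0.le fun u hu => ?_
    obtain ⟨h0, h2⟩ := hsph u hu
    refine ContinuousAt.continuousWithinAt (ContinuousAt.mul ?_ ?_)
    · exact ((hasDerivAt_jou h0).continuousAt.sub continuousAt_const).zpow₀ m (Or.inl h2)
    · exact (continuousAt_const.sub ((continuousAt_id.pow 2).inv₀ (pow_ne_zero 2 h0))).div_const 2
  rw [circleIntegral.integral_congr hr0.le h1, circleIntegral.integral_fun_sum]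
  · simp only [circleIntegral.integral_const_mul,
      circleIntegral_jou_zpow ha hb hab hs hr0 hr]
    rw [Finset.sum_eq_single j]
    · rw [if_pos (by omega)]; ring
    · intro i _ hij
      rw [if_neg (by omega), mul_zero]
    · intro h
      exact absurd (Finset.mem_range.2 (by omega)) h
  · intro i _
    exact (hcont _).const_smul (a := (((Polynomial.hasseDeriv i P).eval x : ℝ) : ℂ))

/-! ### Integral representations on circles -/

/-- The measure `|1 - u²| dτ`, `u = r e^{iτ}`, on one period. For `r = 1` its density is
`2 |sin τ|`, so that it is carried by `cos` to a multiple of Lebesgue measure on `[-1, 1]`. -/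
def circMeas (r : ℝ) : Measure ℝ :=
  (volume.restrict (Ioc 0 (2 * Real.pi))).withDensity
    (fun τ => ENNReal.ofReal ‖1 - circleMap 0 r τ ^ 2‖)

theorem lintegral_circMeas (r : ℝ) {g : ℝ → ℝ≥0∞} (hg : Measurable g) :
    ∫⁻ τ, g τ ∂circMeas r =
      ∫⁻ τ in Ioc 0 (2 * Real.pi), g τ * ENNReal.ofReal ‖1 - circleMap 0 r τ ^ 2‖ := by
  rw [circMeas, lintegral_withDensity_eq_lintegral_mul _ (by fun_prop) hg]
  simp only [Pi.mul_apply, mul_comm]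

instance (r : ℝ) : SFinite (circMeas r) := by unfold circMeas; infer_instance

theorem sq_add_div_le {A B X : ℝ} (hA : 0 < A) (hB : 0 < B) (hX : X ≤ (A + B) ^ 2) :
    X / (A ^ 2 * B ^ 2) ≤ 2 * (1 / A ^ 2) + 2 * (1 / B ^ 2) := by
  have : 2 * (1 / A ^ 2) + 2 * (1 / B ^ 2) = (2 * A ^ 2 + 2 * B ^ 2) / (A ^ 2 * B ^ 2) := by
    field_simp
    ring
  rw [this]
  gcongr
  nlinarith [sq_nonneg (A - B)]

theorem norm_sub_le_add (u a b : ℂ) : ‖a - b‖ ≤ ‖u - a‖ + ‖u - b‖ := by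
  have : a - b = (u - b) - (u - a) := by ring
  rw [this, add_comm]
  exact norm_sub_le _ _

theorem norm_one_sub_sq_le {u a b : ℂ} (hu : ‖u‖ ≤ 1) (ha : ‖a‖ = 1) (hab : a * b = 1) :
    ‖1 - u ^ 2‖ ≤ ‖u - a‖ + ‖u - b‖ := by
  have : 1 - u ^ 2 = -(u * (u - a)) - a * (u - b) := by linear_combination -hab
  rw [this]
  refine (norm_sub_le _ _).trans ?_
  rw [norm_neg, norm_mul, norm_mul, ha, one_mul]
  gcongr
  exact mul_le_of_le_one_left (norm_nonneg _) hu

/-- Kernel bounding `φ^j P^{(j)} / j!` at `cos θ` by the values of `P` on the image of `|u| = r`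
under the Joukowski map, with respect to `circMeas r`. Of the `j + 1` factors `(jou u - cos θ)⁻¹` in
Cauchy's formula, two are kept; each of the other `j - 1`, multiplied by `|sin θ|`, is estimated by
`2 / (1 - r)`. -/
def derivKernel (j : ℕ) (r θ τ : ℝ) : ℝ≥0∞ :=
  ENNReal.ofReal ((2 * Real.pi)⁻¹ * (2 / (1 - r)) ^ (j - 1) *
    (‖circleMap 0 1 θ - circleMap 0 1 (-θ)‖ /
      (‖circleMap 0 r τ - circleMap 0 1 θ‖ ^ 2 * ‖circleMap 0 r τ - circleMap 0 1 (-θ)‖ ^ 2)))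

/-- Kernel bounding the values of a polynomial of degree at most `m` on the image of `|u| = r` by
those on `[-1, 1]`, with respect to `circMeas 1`. Up to the factor `r⁻ᵐ` it is the Poisson kernel
times `(1 - r²) / (|1 - u²| |v - u|)`, where `u = r e^{iτ}` and `v = e^{iθ}`. -/
def innerKernel (m : ℕ) (r τ θ : ℝ) : ℝ≥0∞ :=
  ENNReal.ofReal ((2 * Real.pi)⁻¹ * (r ^ m)⁻¹ *
    ((1 - r ^ 2) ^ 2 / (‖1 - circleMap 0 r τ ^ 2‖ * ‖circleMap 0 1 θ - circleMap 0 r τ‖ ^ 3)))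

theorem measurable_derivKernel (j : ℕ) (r : ℝ) :
    Measurable (Function.uncurry (derivKernel j r)) := by
  unfold derivKernel Function.uncurry
  fun_prop

theorem measurable_innerKernel (m : ℕ) (r : ℝ) :
    Measurable (Function.uncurry (innerKernel m r)) := by
  unfold innerKernel Function.uncurry
  fun_prop

theorem circleMap_mul_circleMap_neg (θ : ℝ) : circleMap 0 1 θ * circleMap 0 1 (-θ) = 1 := by
  rw [circleMap_zero_mul]; simp [circleMap]

theorem circleMap_add_circleMap_neg (θ : ℝ) :
    circleMap 0 1 θ + circleMap 0 1 (-θ) = 2 * ((Real.cos θ : ℝ) : ℂ) := by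
  have := jou_circleMap_one θ
  rw [jou, circleMap_zero_inv, inv_one] at this
  rw [← this]; ring

theorem norm_circleMap_sub_circleMap_neg (θ : ℝ) :
    ‖circleMap 0 1 θ - circleMap 0 1 (-θ)‖ = 2 * |Real.sin θ| := by
  have : circleMap 0 1 θ - circleMap 0 1 (-θ) = 2 * ((Real.sin θ : ℝ) : ℂ) * Complex.I := by
    apply Complex.ext
    · simp [circleMap_zero_re, -Complex.ofReal_sin]
    · simp [circleMap_zero_im, -Complex.ofReal_sin]; ring
  rw [this]
  simp [-Complex.ofReal_sin]

theorem norm_one_sub_circleMap_sq (θ : ℝ) :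
    ‖1 - circleMap 0 1 θ ^ 2‖ = ‖circleMap 0 1 θ - circleMap 0 1 (-θ)‖ := by
  have : 1 - circleMap 0 1 θ ^ 2 =
      -(circleMap 0 1 θ * (circleMap 0 1 θ - circleMap 0 1 (-θ))) := by
    linear_combination -circleMap_mul_circleMap_neg θ
  rw [this, norm_neg, norm_mul, circleMap_one_norm, one_mul]

theorem circleMap_sub_ne {r : ℝ} (hr0 : 0 < r) (hr : r < 1) (τ θ : ℝ) :
    0 < ‖circleMap 0 r τ - circleMap 0 1 θ‖ := by
  rw [norm_pos_iff, sub_ne_zero]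
  intro h
  have := congrArg norm h
  simp [abs_of_pos hr0] at this
  linarith

theorem one_sub_le_norm_sub {r : ℝ} (hr0 : 0 < r) (τ θ : ℝ) :
    1 - r ≤ ‖circleMap 0 r τ - circleMap 0 1 θ‖ := by
  have := norm_sub_norm_le (circleMap 0 1 θ) (circleMap 0 r τ)
  rw [norm_sub_rev]
  simpa [abs_of_pos hr0] using this

/-- Cauchy's formula on the Joukowski ellipse, estimated by absolute values. -/
theorem enorm_hasseDeriv_mul_sin_le (P : Polynomial ℝ) {j : ℕ} (hj : 1 ≤ j) {r : ℝ} (hr0 : 0 < r)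
    (hr : r < 1) (θ : ℝ) :
    ‖(Polynomial.hasseDeriv j P).eval (Real.cos θ) * Real.sin θ ^ j‖ₑ ≤
      ∫⁻ τ, derivKernel j r θ τ * ‖(P.map Complex.ofRealHom).eval (jou (circleMap 0 r τ))‖ₑ
        ∂circMeas r := by
  set a := circleMap 0 1 θ with ha
  set b := circleMap 0 1 (-θ) with hb
  have ha1 : ‖a‖ = 1 := circleMap_one_norm θ
  have hb1 : ‖b‖ = 1 := circleMap_one_norm (-θ)
  have hab : a * b = 1 := circleMap_mul_circleMap_neg θ
  have hs : a + b = 2 * ((Real.cos θ : ℝ) : ℂ) := circleMap_add_circleMap_neg θ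
  have hpi := Real.pi_pos
  have h1 := hasseDeriv_eval_eq_circleIntegral P j ha1 hb1 hab hs hr0 hr
  set D := (Polynomial.hasseDeriv j P).eval (Real.cos θ) with hD
  have hmeas : Measurable fun τ => derivKernel j r θ τ *
      ‖(P.map Complex.ofRealHom).eval (jou (circleMap 0 r τ))‖ₑ := by
    refine ((measurable_derivKernel j r).comp measurable_prodMk_left).mul ?_
    unfold jou
    refine Measurable.enorm (Measurable.comp (Polynomial.continuous _).measurable ?_)
    fun_prop
  rw [lintegral_circMeas r hmeas]
  have h2 : ‖D * Real.sin θ ^ j‖ₑ =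
      ENNReal.ofReal ((2 * Real.pi)⁻¹ * |Real.sin θ| ^ j) *
        ‖-(2 * Real.pi * Complex.I) * (D : ℂ)‖ₑ := by
    rw [← ofReal_norm, ← ofReal_norm, ← ENNReal.ofReal_mul (by positivity)]
    congr 1
    simp only [norm_mul, norm_neg, norm_pow, Real.norm_eq_abs, Complex.norm_real, Complex.norm_I,
      Complex.norm_ofNat, abs_of_pos hpi]
    field_simp
  rw [h2, h1, circleIntegral, intervalIntegral.integral_of_le Real.two_pi_pos.le]
  refine (mul_le_mul_right (enorm_integral_le_lintegral_enorm _) _).trans ?_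
  rw [← lintegral_const_mul' _ _ ENNReal.ofReal_ne_top]
  refine lintegral_mono fun τ => ?_
  rw [deriv_circleMap, derivKernel, ← ofReal_norm, ← ofReal_norm,
    ← ENNReal.ofReal_mul (by positivity), ← ENNReal.ofReal_mul (by have := sub_pos.2 hr; positivity),
    ← ENNReal.ofReal_mul (by have := sub_pos.2 hr; positivity)]
  refine ENNReal.ofReal_le_ofReal ?_
  set u := circleMap 0 r τ with hu
  have hu1 : ‖u‖ = r := by simp [hu, abs_of_pos hr0]
  have hu0 : u ≠ 0 := by rw [← norm_pos_iff, hu1]; exact hr0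
  have hA : 0 < ‖u - a‖ := circleMap_sub_ne hr0 hr τ θ
  have hB : 0 < ‖u - b‖ := circleMap_sub_ne hr0 hr τ (-θ)
  have hA' : 1 - r ≤ ‖u - a‖ := one_sub_le_norm_sub hr0 τ θ
  have hB' : 1 - r ≤ ‖u - b‖ := one_sub_le_norm_sub hr0 τ (-θ)
  rw [jou_sub hu0 hab hs, zpow_neg, show ((j : ℤ) + 1) = ((j + 1 : ℕ) : ℤ) by push_cast; rfl,
    zpow_natCast]
  have hd : (1 - (u ^ 2)⁻¹) / 2 = -(1 - u ^ 2) / (2 * u ^ 2) := by field_simp; ring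
  rw [hd]
  simp only [norm_smul, norm_mul, norm_div, norm_inv, norm_pow, norm_neg, Complex.norm_I,
    Complex.norm_ofNat, hu1]
  rw [← ha, ← hb, norm_circleMap_sub_circleMap_neg θ]
  set A := ‖u - a‖
  set B := ‖u - b‖
  set S := |Real.sin θ|
  set E := ‖(P.map Complex.ofRealHom).eval (jou u)‖
  have hS : 2 * S ≤ A + B := by
    have := norm_sub_le_add u a b
    rwa [norm_circleMap_sub_circleMap_neg θ] at this
  have hS0 : 0 ≤ S := abs_nonneg _
  obtain ⟨i, rfl⟩ : ∃ i, j = i + 1 := ⟨j - 1, by omega⟩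
  -- `2 * S = |a - b| ≤ A + B`, while `A` and `B` are at least `1 - r`.
  have hq : r * (2 * S) / (A * B) ≤ 2 / (1 - r) := by
    have h1r := sub_pos.2 hr
    calc r * (2 * S) / (A * B) ≤ 1 * (A + B) / (A * B) := by gcongr
      _ = 1 / A + 1 / B := by field_simp; ring
      _ ≤ 1 / (1 - r) + 1 / (1 - r) := by gcongr
      _ = 2 / (1 - r) := by ring
  calc _ = (2 * Real.pi)⁻¹ * (r * (2 * S) / (A * B)) ^ i * (r * (2 * S / (A ^ 2 * B ^ 2))) * E *
        ‖1 - u ^ 2‖ := by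
        simp only [div_pow, mul_pow, pow_succ]
        field_simp
    _ ≤ (2 * Real.pi)⁻¹ * (2 / (1 - r)) ^ i * (1 * (2 * S / (A ^ 2 * B ^ 2))) * E *
        ‖1 - u ^ 2‖ := by
        have h1r := sub_pos.2 hr
        gcongr
    _ = _ := by rw [add_tsub_cancel_right, one_mul]

/-- The Poisson formula for `z ^ m * P (jou z)` on the unit disc, estimated by absolute values. -/
theorem enorm_eval_jou_le (P : Polynomial ℝ) {m : ℕ} (hm : P.natDegree ≤ m) {r : ℝ} (hr0 : 0 < r)
    (hr : r < 1) (τ : ℝ) :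
    ‖(P.map Complex.ofRealHom).eval (jou (circleMap 0 r τ))‖ₑ ≤
      ∫⁻ θ, innerKernel m r τ θ * ‖P.eval (Real.cos θ)‖ₑ ∂circMeas 1 := by
  have hpi := Real.pi_pos
  have hmeas : Measurable fun θ => innerKernel m r τ θ * ‖P.eval (Real.cos θ)‖ₑ := by
    refine ((measurable_innerKernel m r).comp measurable_prodMk_left).mul ?_
    exact Measurable.enorm (Measurable.comp (Polynomial.continuous _).measurable (by fun_prop))
  rw [lintegral_circMeas 1 hmeas]
  set u := circleMap 0 r τ with hu
  have hu1 : ‖u‖ = r := by simp [hu, abs_of_pos hr0]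
  have hu0 : u ≠ 0 := by rw [← norm_pos_iff, hu1]; exact hr0
  have hr2 : 0 < 1 - r ^ 2 := by nlinarith
  have hu2 : 1 - u ^ 2 ≠ 0 := by
    intro h
    have h2 : u ^ 2 = 1 := by linear_combination -h
    have := congrArg norm h2
    rw [norm_pow, hu1, norm_one] at this
    nlinarith
  -- `F z = z ^ m * P (jou z)`, a polynomial since `P` has degree at most `m`.
  set F : ℂ → ℂ := fun z => ∑ i ∈ Finset.range (m + 1),
    ((P.coeff i : ℝ) : ℂ) * (z ^ (m - i) * ((z ^ 2 + 1) / 2) ^ i) with hF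
  have hFJ : ∀ z, z ≠ 0 → F z = z ^ m * (P.map Complex.ofRealHom).eval (jou z) := by
    intro z hz
    rw [Polynomial.eval_eq_sum_range' (n := m + 1)
      (lt_of_le_of_lt Polynomial.natDegree_map_le (by omega)), Finset.mul_sum]
    refine Finset.sum_congr rfl fun i hi => ?_
    have hi' : i ≤ m := by rw [Finset.mem_range] at hi; omega
    have : (z ^ 2 + 1) / 2 = z * jou z := by unfold jou; field_simp
    rw [Polynomial.coeff_map, this, mul_pow, ← mul_assoc (z ^ (m - i)), ← pow_add,
      Nat.sub_add_cancel hi']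
    simp only [Complex.ofRealHom_eq_coe]
    ring
  set cu := (starRingEnd ℂ) u with hcu
  have hcu1 : ‖cu‖ = r := by rw [hcu, RCLike.norm_conj, hu1]
  -- The factor `G` equals `1` at `u`. Its numerator `1 - z ^ 2` turns `dθ` into `circMeas 1`, and
  -- its denominator compensates for the growth of this numerator away from `u`.
  set G : ℂ → ℂ := fun z => (1 - z ^ 2) / (1 - u ^ 2) * ((1 - r ^ 2) / (1 - cu * z)) with hG
  have hne : ∀ z : ℂ, ‖z‖ ≤ 1 → 1 - cu * z ≠ 0 := by
    intro z hz h
    have h2 : cu * z = 1 := by linear_combination -h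
    have := congrArg norm h2
    rw [norm_mul, hcu1, norm_one] at this
    nlinarith
  have hGu : G u = 1 := by
    have : cu * u = r ^ 2 := by
      rw [mul_comm, hcu, Complex.mul_conj', hu1]
    have h3 : (1 : ℂ) - r ^ 2 ≠ 0 := by exact_mod_cast hr2.ne'
    simp only [hG, this]
    rw [div_self hu2, div_self h3, one_mul]
  have hdiff : DiffContOnCl ℂ (fun z => F z * G z) (Metric.ball 0 1) := by
    refine DifferentiableOn.diffContOnCl fun z hz => DifferentiableAt.differentiableWithinAt ?_
    rw [closure_ball _ one_ne_zero, mem_closedBall_zero_iff] at hz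
    refine DifferentiableAt.mul ?_ ?_
    · simp only [hF]; fun_prop
    · exact ((by fun_prop : DifferentiableAt ℂ (fun z => (1 - z ^ 2) / (1 - u ^ 2)) z)).mul
        ((by fun_prop : DifferentiableAt ℂ (fun _ : ℂ => (1 - (r : ℂ) ^ 2)) z).div
          (by fun_prop) (hne z hz))
  have hP := hdiff.circleAverage_poissonKernel_smul' (w := u)
    (by rw [mem_ball_zero_iff, hu1]; exact hr)
  rw [Real.circleAverage_def, hGu, mul_one, hFJ u hu0,
    intervalIntegral.integral_of_le Real.two_pi_pos.le] at hP
  have h2 : ‖(P.map Complex.ofRealHom).eval (jou u)‖ₑ =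
      ENNReal.ofReal ((r ^ m)⁻¹) * ‖u ^ m * (P.map Complex.ofRealHom).eval (jou u)‖ₑ := by
    rw [← ofReal_norm, ← ofReal_norm, ← ENNReal.ofReal_mul (by positivity), norm_mul, norm_pow, hu1]
    congr 1
    field_simp
  rw [h2, ← hP, enorm_smul, ← mul_assoc, ← ofReal_norm (2 * Real.pi)⁻¹,
    ← ENNReal.ofReal_mul (by positivity)]
  refine (mul_le_mul_right (enorm_integral_le_lintegral_enorm _) _).trans ?_
  rw [← lintegral_const_mul' _ _ ENNReal.ofReal_ne_top]
  refine lintegral_mono fun θ => ?_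
  set v := circleMap 0 1 θ with hv
  have hv1 : ‖v‖ = 1 := circleMap_one_norm θ
  have hv0 : v ≠ 0 := by rw [← norm_pos_iff, hv1]; exact one_pos
  have hVU : 0 < ‖v - u‖ := by rw [norm_sub_rev]; exact circleMap_sub_ne hr0 hr τ θ
  have hU2 : 0 < ‖1 - u ^ 2‖ := norm_pos_iff.2 hu2
  have hcv : ‖1 - cu * v‖ = ‖v - u‖ := by
    have hvv : v * (starRingEnd ℂ) v = 1 := by rw [Complex.mul_conj']; simp [hv1]
    have : 1 - cu * v = v * (starRingEnd ℂ) (v - u) := by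
      rw [map_sub, mul_sub, hvv, mul_comm]
    rw [this, norm_mul, hv1, one_mul, RCLike.norm_conj]
  have hPv : (P.map Complex.ofRealHom).eval (jou v) = ((P.eval (Real.cos θ) : ℝ) : ℂ) := by
    rw [hv, jou_circleMap_one, Polynomial.eval_map]
    exact Polynomial.eval₂_at_apply Complex.ofRealHom (Real.cos θ)
  rw [innerKernel, ← ofReal_norm, ← ofReal_norm, ← ENNReal.ofReal_mul (by positivity),
    ← ENNReal.ofReal_mul (by positivity), ← ENNReal.ofReal_mul (by positivity)]
  refine ENNReal.ofReal_le_ofReal (le_of_eq ?_)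
  simp only [hFJ v hv0, hG, hPv]
  have hr2' : ‖(1 : ℂ) - r ^ 2‖ = 1 - r ^ 2 := by
    rw [← Complex.ofReal_one, ← Complex.ofReal_pow, ← Complex.ofReal_sub, Complex.norm_real,
      Real.norm_of_nonneg hr2.le]
  simp only [sub_zero, norm_smul, norm_mul, norm_div, norm_pow, hv1, hu1, Complex.norm_real, hcv,
    ← hu, ← hv, hr2', one_pow, one_mul, norm_inv]
  rw [Real.norm_of_nonneg hpi.le, Real.norm_of_nonneg hr2.le, Real.norm_of_nonneg hVU.le,
    Real.norm_of_nonneg zero_le_two]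
  field_simp

/-! ### Bernstein's inequality -/

theorem lintegral_two_inv_norm_sq_le {r : ℝ} (hr0 : 0 < r) (hr : r < 1) {f g : ℝ → ℂ}
    (hf : ∫⁻ τ in Ioc 0 (2 * Real.pi), ENNReal.ofReal (1 / ‖f τ‖ ^ 2) =
      ENNReal.ofReal (2 * Real.pi / (1 - r ^ 2)))
    (hg : ∫⁻ τ in Ioc 0 (2 * Real.pi), ENNReal.ofReal (1 / ‖g τ‖ ^ 2) =
      ENNReal.ofReal (2 * Real.pi / (1 - r ^ 2))) (hfm : Measurable f) {C : ℝ} (hC : 0 ≤ C) :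
    ∫⁻ τ in Ioc 0 (2 * Real.pi), ENNReal.ofReal ((2 * Real.pi)⁻¹ * C *
      (2 * (1 / ‖f τ‖ ^ 2) + 2 * (1 / ‖g τ‖ ^ 2))) ≤ ENNReal.ofReal (2 * (2 / (1 - r)) * C) := by
  have hpi := Real.pi_pos
  have hr2 : 0 < 1 - r ^ 2 := by nlinarith
  have h1 : ∀ τ, ENNReal.ofReal ((2 * Real.pi)⁻¹ * C * (2 * (1 / ‖f τ‖ ^ 2) + 2 * (1 / ‖g τ‖ ^ 2)))
      = ENNReal.ofReal ((2 * Real.pi)⁻¹ * C * 2) *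
        (ENNReal.ofReal (1 / ‖f τ‖ ^ 2) + ENNReal.ofReal (1 / ‖g τ‖ ^ 2)) := by
    intro τ
    rw [← ENNReal.ofReal_add (by positivity) (by positivity), ← ENNReal.ofReal_mul (by positivity)]
    congr 1; ring
  simp only [h1]
  rw [lintegral_const_mul' _ _ ENNReal.ofReal_ne_top, lintegral_add_left (by fun_prop), hf, hg,
    ← ENNReal.ofReal_add (by positivity) (by positivity), ← ENNReal.ofReal_mul (by positivity)]
  refine ENNReal.ofReal_le_ofReal ?_
  have h2 : (2 * Real.pi)⁻¹ * C * 2 * (2 * Real.pi / (1 - r ^ 2) + 2 * Real.pi / (1 - r ^ 2)) =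
      2 * (2 / (1 - r ^ 2)) * C := by field_simp; ring
  rw [h2]
  have h3 : 0 < 1 - r := sub_pos.2 hr
  gcongr
  nlinarith

theorem lintegral_inv_norm_sq_circleMap_sub_circleMap {r : ℝ} (hr0 : 0 < r) (hr : r < 1) (τ : ℝ) :
    ∫⁻ θ in Ioc 0 (2 * Real.pi), ENNReal.ofReal (1 / ‖circleMap 0 r τ - circleMap 0 1 θ‖ ^ 2) =
      ENNReal.ofReal (2 * Real.pi / (1 - r ^ 2)) := by
  have h : ‖circleMap 0 r τ‖ = r := by simp [abs_of_pos hr0]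
  have := lintegral_inv_norm_sq_sub (u := circleMap 0 r τ) (by rw [h]; exact hr)
  rw [h] at this
  simpa only [norm_sub_rev] using this

theorem norm_circleMap_sub_circleMap_neg_comm (r τ θ : ℝ) :
    ‖circleMap 0 r τ - circleMap 0 1 (-θ)‖ = ‖circleMap 0 r (-τ) - circleMap 0 1 θ‖ := by
  rw [← RCLike.norm_conj (circleMap 0 r τ - circleMap 0 1 (-θ)), map_sub, conj_circleMap_zero,
    conj_circleMap_zero, neg_neg]

/-- Since `|a - b|` and `|1 - u²|` are both at most `|u - a| + |u - b|`, the kernel times the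
density is at most a combination of `|u - a|⁻²` and `|u - b|⁻²`, which are Poisson kernels up to a
factor. -/
theorem derivKernel_row (j : ℕ) {r : ℝ} (hr0 : 0 < r) (hr : r < 1) (θ : ℝ) :
    ∫⁻ τ, derivKernel j r θ τ ∂circMeas r ≤
      ENNReal.ofReal (2 * (2 / (1 - r)) * (2 / (1 - r)) ^ (j - 1)) := by
  have h1r : 0 < 1 - r := sub_pos.2 hr
  have hpi := Real.pi_pos
  rw [lintegral_circMeas r (g := fun τ => derivKernel j r θ τ)
    (by unfold derivKernel; fun_prop)]
  refine le_trans (lintegral_mono fun τ => ?_) (lintegral_two_inv_norm_sq_le hr0 hr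
    (f := fun τ => circleMap 0 r τ - circleMap 0 1 θ)
    (g := fun τ => circleMap 0 r τ - circleMap 0 1 (-θ))
    (lintegral_inv_norm_sq_circleMap_sub hr0.le hr (circleMap_one_norm θ))
    (lintegral_inv_norm_sq_circleMap_sub hr0.le hr (circleMap_one_norm (-θ)))
    (by fun_prop) (C := (2 / (1 - r)) ^ (j - 1)) (by positivity))
  rw [derivKernel, ← ENNReal.ofReal_mul (by positivity)]
  refine ENNReal.ofReal_le_ofReal ?_
  rw [mul_assoc _ (_ / _)]
  refine mul_le_mul_of_nonneg_left ?_ (by positivity)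
  rw [div_mul_eq_mul_div]
  refine sq_add_div_le (circleMap_sub_ne hr0 hr τ θ) (circleMap_sub_ne hr0 hr τ (-θ)) ?_
  rw [sq (_ + _)]
  gcongr
  · exact norm_sub_le_add _ _ _
  · exact norm_one_sub_sq_le (by simpa [abs_of_pos hr0] using hr.le) (circleMap_one_norm θ)
      (circleMap_mul_circleMap_neg θ)

theorem derivKernel_col (j : ℕ) {r : ℝ} (hr0 : 0 < r) (hr : r < 1) (τ : ℝ) :
    ∫⁻ θ, derivKernel j r θ τ ∂circMeas 1 ≤
      ENNReal.ofReal (2 * (2 / (1 - r)) * (2 / (1 - r)) ^ (j - 1)) := by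
  have h1r : 0 < 1 - r := sub_pos.2 hr
  have hpi := Real.pi_pos
  rw [lintegral_circMeas 1 (g := fun θ => derivKernel j r θ τ)
    (by unfold derivKernel; fun_prop)]
  refine le_trans (lintegral_mono fun θ => ?_) (lintegral_two_inv_norm_sq_le hr0 hr
    (f := fun θ => circleMap 0 r τ - circleMap 0 1 θ)
    (g := fun θ => circleMap 0 r (-τ) - circleMap 0 1 θ)
    (lintegral_inv_norm_sq_circleMap_sub_circleMap hr0 hr τ)
    (lintegral_inv_norm_sq_circleMap_sub_circleMap hr0 hr (-τ))
    (by fun_prop) (C := (2 / (1 - r)) ^ (j - 1)) (by positivity))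
  rw [derivKernel, ← ENNReal.ofReal_mul (by positivity), ← norm_circleMap_sub_circleMap_neg_comm]
  refine ENNReal.ofReal_le_ofReal ?_
  rw [mul_assoc]
  gcongr
  rw [div_mul_eq_mul_div]
  refine sq_add_div_le (circleMap_sub_ne hr0 hr τ θ) (circleMap_sub_ne hr0 hr τ (-θ)) ?_
  rw [norm_one_sub_circleMap_sq, sq]
  gcongr
  · exact norm_sub_le_add _ _ _
  · exact norm_sub_le_add _ _ _

/-- Common last step of `innerKernel_row` and `innerKernel_col`: integrate a multiple of the Poisson
kernel. -/
theorem innerKernel_bound {m : ℕ} {r : ℝ} (hr0 : 0 < r) (hr : r < 1) {f : ℝ → ℂ}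
    (hf : ∫⁻ θ in Ioc 0 (2 * Real.pi), ENNReal.ofReal (1 / ‖f θ‖ ^ 2) =
      ENNReal.ofReal (2 * Real.pi / (1 - r ^ 2))) (g : ℝ → ℝ≥0∞)
    (hg : ∀ θ, g θ ≤ ENNReal.ofReal ((2 * Real.pi)⁻¹ * (r ^ m)⁻¹ *
      (4 * (1 - r ^ 2) * (1 / ‖f θ‖ ^ 2)))) :
    ∫⁻ θ in Ioc 0 (2 * Real.pi), g θ ≤ ENNReal.ofReal (4 * (r ^ m)⁻¹) := by
  have hpi := Real.pi_pos
  have hr2 : 0 < 1 - r ^ 2 := by nlinarith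
  refine (lintegral_mono hg).trans ?_
  have : ∀ θ, ENNReal.ofReal ((2 * Real.pi)⁻¹ * (r ^ m)⁻¹ * (4 * (1 - r ^ 2) * (1 / ‖f θ‖ ^ 2))) =
      ENNReal.ofReal ((2 * Real.pi)⁻¹ * (r ^ m)⁻¹ * (4 * (1 - r ^ 2))) *
        ENNReal.ofReal (1 / ‖f θ‖ ^ 2) := by
    intro θ
    rw [← ENNReal.ofReal_mul (by positivity), mul_assoc _ (4 * (1 - r ^ 2))]
  simp only [this]
  rw [lintegral_const_mul' _ _ ENNReal.ofReal_ne_top, hf, ← ENNReal.ofReal_mul (by positivity)]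
  refine ENNReal.ofReal_le_ofReal (le_of_eq ?_)
  field_simp

theorem one_sub_sq_le_norm {r : ℝ} (τ : ℝ) : 1 - r ^ 2 ≤ ‖1 - circleMap 0 r τ ^ 2‖ := by
  have := norm_sub_norm_le 1 (circleMap 0 r τ ^ 2)
  simpa using this

/-- Here `|1 - v²| ≤ |1 - u²| + 2 |u - v|`, and both `|1 - u²|` and `2 |u - v|` are at least
`1 - r²`. -/
theorem innerKernel_row (m : ℕ) {r : ℝ} (hr0 : 0 < r) (hr : r < 1) (τ : ℝ) :
    ∫⁻ θ, innerKernel m r τ θ ∂circMeas 1 ≤ ENNReal.ofReal (4 * (r ^ m)⁻¹) := by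
  have hpi := Real.pi_pos
  have hr2 : 0 < 1 - r ^ 2 := by nlinarith
  rw [lintegral_circMeas 1 (g := fun θ => innerKernel m r τ θ)
    (by unfold innerKernel; fun_prop)]
  refine innerKernel_bound hr0 hr
    (lintegral_inv_norm_sq_circleMap_sub_circleMap hr0 hr τ) _ fun θ => ?_
  rw [innerKernel, ← ENNReal.ofReal_mul (by positivity)]
  refine ENNReal.ofReal_le_ofReal ?_
  rw [mul_assoc _ (_ / _), norm_sub_rev (circleMap 0 1 θ)]
  refine mul_le_mul_of_nonneg_left ?_ (by positivity)
  have hA := circleMap_sub_ne hr0 hr τ θ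
  have hU : 1 - r ^ 2 ≤ ‖1 - circleMap 0 r τ ^ 2‖ := one_sub_sq_le_norm τ
  have hV : ‖1 - circleMap 0 1 θ ^ 2‖ ≤ ‖1 - circleMap 0 r τ ^ 2‖ +
      2 * ‖circleMap 0 r τ - circleMap 0 1 θ‖ := by
    have : 1 - circleMap 0 1 θ ^ 2 = (1 - circleMap 0 r τ ^ 2) +
      (circleMap 0 r τ + circleMap 0 1 θ) * (circleMap 0 r τ - circleMap 0 1 θ) := by ring
    rw [this]
    refine (norm_add_le _ _).trans ?_
    rw [norm_mul]
    gcongr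
    refine (norm_add_le _ _).trans ?_
    simp [abs_of_pos hr0]
    linarith
  have hA' := one_sub_le_norm_sub hr0 τ θ
  set A := ‖circleMap 0 r τ - circleMap 0 1 θ‖
  set U := ‖1 - circleMap 0 r τ ^ 2‖
  set V := ‖1 - circleMap 0 1 θ ^ 2‖
  have hU0 : 0 < U := hr2.trans_le hU
  have h1 : 1 - r ^ 2 ≤ 2 * A := by nlinarith
  rw [div_mul_eq_mul_div, mul_one_div, div_le_div_iff₀ (by positivity) (by positivity)]
  have h2 : (1 - r ^ 2) * V ≤ 4 * U * A := by
    calc (1 - r ^ 2) * V ≤ (1 - r ^ 2) * (U + 2 * A) := by gcongr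
      _ = (1 - r ^ 2) * U + 2 * A * (1 - r ^ 2) := by ring
      _ ≤ (2 * A) * U + 2 * A * U := by gcongr
      _ = _ := by ring
  calc (1 - r ^ 2) ^ 2 * V * A ^ 2 = (1 - r ^ 2) * A ^ 2 * ((1 - r ^ 2) * V) := by ring
    _ ≤ (1 - r ^ 2) * A ^ 2 * (4 * U * A) := by gcongr
    _ = _ := by ring

theorem innerKernel_col (m : ℕ) {r : ℝ} (hr0 : 0 < r) (hr : r < 1) (θ : ℝ) :
    ∫⁻ τ, innerKernel m r τ θ ∂circMeas r ≤ ENNReal.ofReal (4 * (r ^ m)⁻¹) := by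
  have hpi := Real.pi_pos
  have hr2 : 0 < 1 - r ^ 2 := by nlinarith
  rw [lintegral_circMeas r (g := fun τ => innerKernel m r τ θ)
    (by unfold innerKernel; fun_prop)]
  refine innerKernel_bound hr0 hr
    (lintegral_inv_norm_sq_circleMap_sub hr0.le hr (circleMap_one_norm θ)) _ fun τ => ?_
  rw [innerKernel, ← ENNReal.ofReal_mul (by positivity)]
  refine ENNReal.ofReal_le_ofReal ?_
  rw [mul_assoc _ (_ / _), norm_sub_rev (circleMap 0 1 θ)]
  refine mul_le_mul_of_nonneg_left ?_ (by positivity)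
  have hA := circleMap_sub_ne hr0 hr τ θ
  have hU : 1 - r ^ 2 ≤ ‖1 - circleMap 0 r τ ^ 2‖ := one_sub_sq_le_norm τ
  have hA' := one_sub_le_norm_sub hr0 τ θ
  set A := ‖circleMap 0 r τ - circleMap 0 1 θ‖
  set U := ‖1 - circleMap 0 r τ ^ 2‖
  have hU0 : 0 < U := hr2.trans_le hU
  have h1 : 1 - r ^ 2 ≤ 2 * A := by nlinarith
  rw [div_mul_eq_mul_div, mul_one_div, div_le_div_iff₀ (by positivity) (by positivity)]
  calc (1 - r ^ 2) ^ 2 * U * A ^ 2 = (1 - r ^ 2) * A ^ 2 * U * (1 - r ^ 2) := by ring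
    _ ≤ (1 - r ^ 2) * A ^ 2 * U * (4 * A) := by gcongr; linarith
    _ = _ := by ring

/-- Bernstein's inequality in the angle variable, with the radius `r` still free. -/
theorem eLpNorm_hasseDeriv_cos_le {p : ℝ≥0∞} (hp : 1 ≤ p) (P : Polynomial ℝ) {m : ℕ}
    (hm : P.natDegree ≤ m) {j : ℕ} (hj : 1 ≤ j) {r : ℝ} (hr0 : 0 < r) (hr : r < 1) :
    eLpNorm (fun θ => (Polynomial.hasseDeriv j P).eval (Real.cos θ) * Real.sin θ ^ j) p
      (circMeas 1) ≤ ENNReal.ofReal (8 * (r ^ m)⁻¹ * (2 / (1 - r)) ^ j) *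
        eLpNorm (fun θ => P.eval (Real.cos θ)) p (circMeas 1) := by
  have h1r : 0 < 1 - r := sub_pos.2 hr
  have h1 := eLpNorm_lintegral_kernel_le (measurable_derivKernel j r)
    (derivKernel_row j hr0 hr) (derivKernel_col j hr0 hr)
    (g := fun τ => ‖(P.map Complex.ofRealHom).eval (jou (circleMap 0 r τ))‖ₑ)
    (by unfold jou
        exact Measurable.enorm (Measurable.comp (Polynomial.continuous _).measurable
          (by fun_prop))) hp
  have h2 := eLpNorm_lintegral_kernel_le (measurable_innerKernel m r)
    (innerKernel_row m hr0 hr) (innerKernel_col m hr0 hr)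
    (g := fun θ => ‖P.eval (Real.cos θ)‖ₑ)
    (Measurable.enorm (Measurable.comp (Polynomial.continuous _).measurable (by fun_prop))) hp
  rw [eLpNorm_enorm] at h1 h2
  calc _ ≤ _ := eLpNorm_mono_enorm fun θ => by
        rw [enorm_eq_self]; exact enorm_hasseDeriv_mul_sin_le P hj hr0 hr θ
    _ ≤ _ := h1
    _ ≤ ENNReal.ofReal (2 * (2 / (1 - r)) * (2 / (1 - r)) ^ (j - 1)) *
        (ENNReal.ofReal (4 * (r ^ m)⁻¹) * eLpNorm (fun θ => P.eval (Real.cos θ)) p (circMeas 1)) := by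
        gcongr
        refine le_trans (eLpNorm_mono_enorm fun τ => ?_) h2
        rw [enorm_eq_self]; exact enorm_eval_jou_le P hm hr0 hr τ
    _ = _ := by
        rw [← mul_assoc, ← ENNReal.ofReal_mul (by positivity)]
        congr 2
        obtain ⟨i, rfl⟩ : ∃ i, j = i + 1 := ⟨j - 1, by omega⟩
        rw [add_tsub_cancel_right, pow_succ]
        ring

/-- The factor `4` comes from the density `2 |sin θ|` and from `cos` being two-to-one on a
period. -/
theorem map_cos_circMeas : Measure.map Real.cos (circMeas 1) = (4 : ℝ≥0∞) • mu := by
  have hpi := Real.pi_pos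
  ext s hs
  rw [Measure.map_apply Real.measurable_cos hs, circMeas,
    withDensity_apply _ (Real.measurable_cos hs),
    Measure.restrict_restrict (Real.measurable_cos hs),
    Measure.smul_apply, smul_eq_mul, mu, Measure.restrict_apply hs]
  simp only [norm_one_sub_circleMap_sq, norm_circleMap_sub_circleMap_neg]
  set g : ℝ → ℝ≥0∞ := fun θ => (Real.cos ⁻¹' s).indicator
    (fun θ => ENNReal.ofReal (2 * |Real.sin θ|)) θ with hg
  have e1 : ∫⁻ θ in Real.cos ⁻¹' s ∩ Ioc 0 (2 * Real.pi), ENNReal.ofReal (2 * |Real.sin θ|) =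
      ∫⁻ θ in Ioc 0 (2 * Real.pi), g θ := by
    rw [← Measure.restrict_restrict (Real.measurable_cos hs),
      lintegral_indicator (Real.measurable_cos hs)]
  have e2 : Ioc 0 (2 * Real.pi) = Ioc 0 Real.pi ∪ Ioc Real.pi (2 * Real.pi) := by
    rw [Ioc_union_Ioc_eq_Ioc hpi.le (by linarith)]
  have e3 : ∫⁻ θ in Ioc 0 Real.pi, g θ = 2 * volume (s ∩ Icc (-1) 1) := by
    have h := lintegral_image_eq_lintegral_abs_deriv_mul (s := Icc 0 Real.pi) (f := Real.cos)
      (f' := fun θ => -Real.sin θ) measurableSet_Icc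
      (fun x _ => (Real.hasDerivAt_cos x).hasDerivWithinAt) Real.injOn_cos
      (fun x => s.indicator (fun _ => (2 : ℝ≥0∞)) x)
    rw [Real.bijOn_cos.image_eq, lintegral_indicator hs, Measure.restrict_restrict hs,
      setLIntegral_const] at h
    rw [h, ← restrict_Ioc_eq_restrict_Icc]
    refine lintegral_congr fun θ => ?_
    simp only [hg, abs_neg]
    by_cases hθ : Real.cos θ ∈ s
    · rw [indicator_of_mem (by exact hθ), indicator_of_mem hθ, ENNReal.ofReal_mul zero_le_two,
        mul_comm]
      simp
    · rw [indicator_of_notMem (by exact hθ), indicator_of_notMem hθ, mul_zero]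
  have e4 : ∫⁻ θ in Ioc Real.pi (2 * Real.pi), g θ = ∫⁻ θ in Ioc 0 Real.pi, g θ := by
    have h :=
      (Measure.measurePreserving_sub_left volume (2 * Real.pi)).setLIntegral_comp_preimage_emb
      (MeasurableEquiv.subLeft (2 * Real.pi)).measurableEmbedding g (Ico 0 Real.pi)
    have hpre : (fun x => 2 * Real.pi - x) ⁻¹' Ico 0 Real.pi = Ioc Real.pi (2 * Real.pi) := by
      ext x
      simp only [mem_preimage, mem_Ico, mem_Ioc]
      constructor <;> rintro ⟨h1, h2⟩ <;> constructor <;> linarith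
    rw [hpre] at h
    rw [restrict_Ioc_eq_restrict_Icc (a := 0), ← restrict_Ico_eq_restrict_Icc, ← h]
    refine lintegral_congr fun θ => ?_
    have hiff : 2 * Real.pi - θ ∈ Real.cos ⁻¹' s ↔ θ ∈ Real.cos ⁻¹' s := by
      rw [mem_preimage, mem_preimage, Real.cos_two_pi_sub]
    by_cases hθ : θ ∈ Real.cos ⁻¹' s
    · simp only [hg, indicator_of_mem hθ, indicator_of_mem (hiff.2 hθ), Real.sin_two_pi_sub,
        abs_neg]
    · simp only [hg, indicator_of_notMem hθ, indicator_of_notMem (mt hiff.1 hθ)]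
  rw [e1, e2, lintegral_union measurableSet_Ioc (Ioc_disjoint_Ioc_of_le le_rfl), e4, e3]
  ring

theorem eLpNorm_comp_cos (p : ℝ≥0∞) {g : ℝ → ℝ} (hg : Measurable g) :
    eLpNorm (fun θ => g (Real.cos θ)) p (circMeas 1) =
      (4 : ℝ≥0∞) ^ (1 / p).toReal * eLpNorm g p mu := by
  have := eLpNorm_map_measure (p := p) (μ := circMeas 1) (f := Real.cos) (g := g)
    hg.aestronglyMeasurable Real.measurable_cos.aemeasurable
  rw [map_cos_circMeas, eLpNorm_smul_measure_of_ne_zero (by norm_num), smul_eq_mul] at this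
  exact this.symm

/-- **Bernstein's inequality** in `L_p[-1, 1]`, `1 ≤ p ≤ ∞`. The Hasse derivative is `P^{(j)} / j!`,
so that the constants grow only geometrically in `j`. -/
theorem bernstein {p : ℝ≥0∞} (hp : 1 ≤ p) (P : Polynomial ℝ) {n : ℕ} (hn : 1 ≤ n)
    (hP : P.natDegree ≤ n) (j : ℕ) :
    eLpNorm (fun x => (Polynomial.hasseDeriv j P).eval x * wphi x ^ j) p mu ≤
      ENNReal.ofReal (24 * (4 * n) ^ j) * eLpNorm (fun x => P.eval x) p mu := by
  have hn' : (1 : ℝ) ≤ n := by exact_mod_cast hn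
  rcases Nat.eq_zero_or_pos j with rfl | hj
  · simp only [Polynomial.hasseDeriv_zero', pow_zero, mul_one]
    refine le_mul_of_one_le_left zero_le ?_
    rw [ENNReal.one_le_ofReal]; norm_num
  -- With this radius `r⁻ⁿ ≤ e` and `2 / (1 - r) = 2 (n + 1) ≤ 4 n`.
  set r : ℝ := n / (n + 1) with hr
  have hr0 : 0 < r := by positivity
  have hr1 : r < 1 := by rw [hr, div_lt_one (by positivity)]; linarith
  have h := eLpNorm_hasseDeriv_cos_le hp P hP hj hr0 hr1
  have h2 : eLpNorm (fun θ => (Polynomial.hasseDeriv j P).eval (Real.cos θ) * Real.sin θ ^ j) p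
      (circMeas 1) = eLpNorm (fun θ => (Polynomial.hasseDeriv j P).eval (Real.cos θ) *
        wphi (Real.cos θ) ^ j) p (circMeas 1) := by
    refine eLpNorm_congr_norm_ae (Eventually.of_forall fun θ => ?_)
    simp only [norm_mul, norm_pow, wphi, Real.norm_eq_abs, ← Real.abs_sin_eq_sqrt_one_sub_cos_sq,
      abs_abs]
  have hw : Measurable wphi := by unfold wphi; fun_prop
  rw [h2, eLpNorm_comp_cos p (g := fun x => (Polynomial.hasseDeriv j P).eval x * wphi x ^ j)
    ((Polynomial.continuous _).measurable.mul (hw.pow_const j)),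
    eLpNorm_comp_cos p (Polynomial.continuous P).measurable, mul_left_comm,
    ENNReal.mul_le_mul_iff_right (by simp) (by simp)] at h
  refine h.trans ?_
  gcongr
  · rw [hr, ← inv_pow, inv_div]
    have h3 : ((n : ℝ) + 1) / n ≤ Real.exp (1 / n) := by
      have := Real.add_one_le_exp (1 / (n : ℝ))
      refine le_trans (le_of_eq ?_) this
      field_simp
      ring
    calc 8 * (((n : ℝ) + 1) / n) ^ n ≤ 8 * Real.exp (1 / n) ^ n := by gcongr
      _ = 8 * Real.exp 1 := by rw [← Real.exp_nat_mul]; congr 2; field_simp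
      _ ≤ 24 := by have := Real.exp_one_lt_d9; linarith
  · rw [hr, one_sub_div (by positivity), add_sub_cancel_left, div_div_eq_mul_div, div_one]
    linarith

/-! ### Differences with step proportional to `φ` -/

theorem wphi_nonneg (x : ℝ) : 0 ≤ wphi x := Real.sqrt_nonneg _

theorem measurable_wphi : Measurable wphi := by unfold wphi; fun_prop

theorem wphi_sq {x : ℝ} (hx : x ∈ Icc (-1 : ℝ) 1) : wphi x ^ 2 = 1 - x ^ 2 := by
  rw [wphi, Real.sq_sqrt]
  nlinarith [hx.1, hx.2]

theorem wphi_pos {x : ℝ} (hx : x ∈ Ioo (-1 : ℝ) 1) : 0 < wphi x := by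
  rw [wphi, Real.sqrt_pos]
  nlinarith [hx.1, hx.2]

/-- The interior points `x` of `[-1, 1]` with `x ± δ φ(x) / 2 ∈ [-1, 1]`. For `δ = k h` these are
the points of `(-1, 1)` at which the difference with step `h φ(x)` is not set to `0`. -/
def diffDom (δ : ℝ) : Set ℝ :=
  {x | x ∈ Ioo (-1 : ℝ) 1 ∧ x - δ * wphi x / 2 ∈ Icc (-1 : ℝ) 1 ∧
    x + δ * wphi x / 2 ∈ Icc (-1 : ℝ) 1}

theorem measurableSet_diffDom (δ : ℝ) : MeasurableSet (diffDom δ) := by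
  have := measurable_wphi
  refine measurableSet_Ioo.inter (MeasurableSet.inter ?_ ?_)
  · exact measurableSet_preimage (by fun_prop) measurableSet_Icc
  · exact measurableSet_preimage (by fun_prop) measurableSet_Icc

theorem add_mul_wphi_mem {δ a x : ℝ} (hx : x ∈ diffDom δ) (ha : |a| ≤ δ / 2) :
    x + a * wphi x ∈ Icc (-1 : ℝ) 1 := by
  obtain ⟨-, h1, h2⟩ := hx
  have h3 := abs_le.1 ha
  have h4 := wphi_nonneg x
  constructor
  · nlinarith [h1.1]
  · nlinarith [h2.2]

/-- On `diffDom δ` the derivative of `δ φ`, which is `-δ x / φ(x)`, is at most `1` in absolute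
value. -/
theorem mul_abs_le_wphi {δ x : ℝ} (hx : x ∈ diffDom δ) : δ * |x| ≤ wphi x := by
  obtain ⟨h0, h1, h2⟩ := hx
  have hw := wphi_pos h0
  have hs := wphi_sq (Ioo_subset_Icc_self h0)
  have hb : δ * wphi x / 2 ≤ 1 - |x| := by
    rcases abs_cases x with ⟨h, -⟩ | ⟨h, -⟩ <;> rw [h] <;> linarith [h1.1, h2.2]
  refine le_of_mul_le_mul_right (?_ : δ * |x| * wphi x ≤ wphi x * wphi x) hw
  have hx1 : |x| < 1 := abs_lt.2 h0
  have hx0 := abs_nonneg x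
  have : wphi x * wphi x = (1 - |x|) * (1 + |x|) := by
    rw [← sq, hs, ← sq_abs x]; ring
  nlinarith

/-- The shift `x ↦ x + a φ(x)` contracts distances by at most a factor `2`. -/
theorem abs_sub_le_of_diffDom {δ a x y : ℝ} (hx : x ∈ diffDom δ) (hy : y ∈ diffDom δ)
    (ha : |a| ≤ δ / 2) :
    |x - y| ≤ 2 * |(x + a * wphi x) - (y + a * wphi y)| := by
  have hwx := wphi_pos hx.1
  have hwy := wphi_pos hy.1
  have hsx := wphi_sq (Ioo_subset_Icc_self hx.1)
  have hsy := wphi_sq (Ioo_subset_Icc_self hy.1)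
  have hbx := mul_abs_le_wphi hx
  have hby := mul_abs_le_wphi hy
  have key : |a * (wphi x - wphi y)| ≤ |x - y| / 2 := by
    refine le_of_mul_le_mul_right ?_ (add_pos hwx hwy)
    calc |a * (wphi x - wphi y)| * (wphi x + wphi y)
        = |a| * |(wphi x - wphi y) * (wphi x + wphi y)| := by
          rw [abs_mul, abs_mul, abs_of_pos (add_pos hwx hwy), mul_assoc]
      _ = |a| * (|x - y| * |x + y|) := by
          have : (wphi x - wphi y) * (wphi x + wphi y) = -((x - y) * (x + y)) := by nlinarith
          rw [this, abs_neg, abs_mul]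
      _ ≤ δ / 2 * (|x - y| * (|x| + |y|)) := by
          have hδ : 0 ≤ δ / 2 := (abs_nonneg a).trans ha
          gcongr
          exact abs_add_le x y
      _ = |x - y| / 2 * (δ * |x| + δ * |y|) := by ring
      _ ≤ |x - y| / 2 * (wphi x + wphi y) := by gcongr
  have h2 : x - y = ((x + a * wphi x) - (y + a * wphi y)) - a * (wphi x - wphi y) := by ring
  have h3 := abs_sub ((x + a * wphi x) - (y + a * wphi y)) (a * (wphi x - wphi y))
  rw [← h2] at h3
  linarith

/-- The inverse of the shift is Lipschitz with constant `2`, so it at most doubles the measure of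
sets. -/
theorem map_restrict_diffDom_le {δ a : ℝ} (ha : |a| ≤ δ / 2) :
    Measure.map (fun x => x + a * wphi x) (volume.restrict (diffDom δ)) ≤ (2 : ℝ≥0∞) • mu := by
  have hT : Measurable fun x => x + a * wphi x := by have := measurable_wphi; fun_prop
  refine Measure.le_iff.2 fun s hs => ?_
  rw [Measure.map_apply hT hs, Measure.restrict_apply (hT hs), Measure.smul_apply, smul_eq_mul, mu,
    Measure.restrict_apply hs]
  set T : ℝ → ℝ := fun x => x + a * wphi x
  set S := T ⁻¹' s ∩ diffDom δ
  have hinj : InjOn T (diffDom δ) := by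
    intro x hx y hy hxy
    have := abs_sub_le_of_diffDom hx hy ha
    change x + a * wphi x = y + a * wphi y at hxy
    rw [hxy, sub_self, abs_zero, mul_zero] at this
    exact sub_eq_zero.1 (abs_nonpos_iff.1 this)
  have hS : S ⊆ diffDom δ := inter_subset_right
  have hlip : LipschitzOnWith 2 (Function.invFunOn T (diffDom δ)) (T '' S) := by
    refine LipschitzOnWith.of_dist_le_mul ?_
    rintro _ ⟨x, hx, rfl⟩ _ ⟨y, hy, rfl⟩
    rw [hinj.leftInvOn_invFunOn (hS hx), hinj.leftInvOn_invFunOn (hS hy)]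
    exact abs_sub_le_of_diffDom (hS hx) (hS hy) ha
  have himg : Function.invFunOn T (diffDom δ) '' (T '' S) = S := by
    rw [image_image]
    refine (image_congr fun x hx => hinj.leftInvOn_invFunOn (hS hx)).trans (image_id' S)
  have h := hlip.hausdorffMeasure_image_le (d := 1) zero_le_one
  rw [himg, hausdorffMeasure_real, ENNReal.rpow_one] at h
  refine h.trans ?_
  have hsub : T '' S ⊆ s ∩ Icc (-1) 1 := by
    rintro _ ⟨x, hx, rfl⟩
    exact ⟨hx.1, add_mul_wphi_mem hx.2 ha⟩
  exact mul_le_mul_right (measure_mono hsub) _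

theorem aestronglyMeasurable_comp_shift {δ a : ℝ} (ha : |a| ≤ δ / 2) {G : ℝ → ℝ}
    (hG : AEStronglyMeasurable G mu) :
    AEStronglyMeasurable (fun x => G (x + a * wphi x)) (volume.restrict (diffDom δ)) := by
  have hT : Measurable fun x => x + a * wphi x := by have := measurable_wphi; fun_prop
  have hG' : AEStronglyMeasurable G
      (Measure.map (fun x => x + a * wphi x) (volume.restrict (diffDom δ))) :=
    hG.mono_ac ((Measure.absolutelyContinuous_of_le (map_restrict_diffDom_le ha)).trans
      Measure.smul_absolutelyContinuous)
  exact hG'.comp_measurable hT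

/-- The factor is `2 ^ (1 / p)`, bounded by `2`. -/
theorem eLpNorm_comp_shift_le {p : ℝ≥0∞} (hp : 1 ≤ p) {δ a : ℝ} (ha : |a| ≤ δ / 2) {G : ℝ → ℝ}
    (hG : AEStronglyMeasurable G mu) :
    eLpNorm (fun x => G (x + a * wphi x)) p (volume.restrict (diffDom δ)) ≤
      2 * eLpNorm G p mu := by
  have hT : Measurable fun x => x + a * wphi x := by have := measurable_wphi; fun_prop
  have hG' : AEStronglyMeasurable G
      (Measure.map (fun x => x + a * wphi x) (volume.restrict (diffDom δ))) :=
    hG.mono_ac ((Measure.absolutelyContinuous_of_le (map_restrict_diffDom_le ha)).trans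
      Measure.smul_absolutelyContinuous)
  have h := eLpNorm_map_measure (p := p) hG' hT.aemeasurable
  change eLpNorm (G ∘ fun x => x + a * wphi x) p _ ≤ _
  rw [← h]
  refine (eLpNorm_mono_measure G (map_restrict_diffDom_le ha)).trans ?_
  rw [eLpNorm_smul_measure_of_ne_zero two_ne_zero, smul_eq_mul]
  gcongr
  refine (ENNReal.rpow_le_rpow_of_exponent_le one_le_two (z := 1) ?_).trans_eq
    (ENNReal.rpow_one 2)
  have : 1 / p ≤ 1 := ENNReal.div_le_of_le_mul (by simpa using hp)
  simpa using ENNReal.toReal_mono ENNReal.one_ne_top this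

/-- The weight `𝒲_δ` is dominated by `φ` at every point used by the difference. -/
theorem wt_le_wphi {δ a x : ℝ} (hx : x ∈ diffDom δ) (ha : |a| ≤ δ / 2) :
    wt δ x ≤ wphi (x + a * wphi x) := by
  obtain ⟨h0, h1, h2⟩ := hx
  have h3 := abs_le.1 ha
  have hw := wphi_nonneg x
  rw [wt, wphi.eq_def (x + _)]
  refine Real.sqrt_le_sqrt ?_
  have : 1 - (x + a * wphi x) ^ 2 = (1 - x - a * wphi x) * (1 + x + a * wphi x) := by ring
  change _ ≤ 1 - (x + a * wphi x) ^ 2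
  rw [this]
  refine mul_le_mul ?_ ?_ ?_ ?_
  · nlinarith
  · nlinarith
  · linarith [h1.1]
  · have := (add_mul_wphi_mem ⟨h0, h1, h2⟩ ha).2
    linarith

theorem wt_nonneg (δ x : ℝ) : 0 ≤ wt δ x := Real.sqrt_nonneg _

theorem abs_sub_half_mul_le {k i : ℕ} (hi : i ∈ Finset.range (k + 1)) {h : ℝ} (hh : 0 ≤ h) :
    |((i : ℝ) - k / 2) * h| ≤ k * h / 2 := by
  have : (i : ℝ) ≤ k := by exact_mod_cast Nat.lt_succ_iff.1 (Finset.mem_range.1 hi)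
  have h0 : (0 : ℝ) ≤ i := Nat.cast_nonneg i
  rw [abs_mul, abs_of_nonneg hh, mul_div_right_comm]
  refine mul_le_mul_of_nonneg_right ?_ hh
  rw [abs_le]; constructor <;> linarith

theorem mu_restrict_diffDom (δ : ℝ) : mu.restrict (diffDom δ) = volume.restrict (diffDom δ) := by
  rw [mu, Measure.restrict_restrict (measurableSet_diffDom δ),
    inter_eq_self_of_subset_left fun x hx => Ioo_subset_Icc_self hx.1]

theorem ae_mem_Ioo : ∀ᵐ x ∂mu, x ∈ Ioo (-1 : ℝ) 1 := by
  rw [mu, ← restrict_Ioo_eq_restrict_Icc]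
  exact ae_restrict_mem measurableSet_Ioo

/-- The two sides may differ only at `±1`, where `φ` vanishes and `diffDom` excludes the point. -/
theorem wt_mul_symDiff_ae_eq (k r : ℕ) (h : ℝ) (F : ℝ → ℝ) :
    (fun x => wt (k * h) x ^ r * symDiff k (h * wphi x) F x) =ᵐ[mu]
      (diffDom (k * h)).indicator (fun x => ∑ i ∈ Finset.range (k + 1),
        ((k.choose i : ℝ) * (-1) ^ (k - i)) •
          (wt (k * h) x ^ r * F (x + (((i : ℝ) - k / 2) * h) * wphi x))) := by
  filter_upwards [ae_mem_Ioo] with x hx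
  by_cases hD : x ∈ diffDom (k * h)
  · rw [indicator_of_mem hD, symDiff, if_pos, Finset.mul_sum]
    · refine Finset.sum_congr rfl fun i _ => ?_
      rw [smul_eq_mul, mul_assoc _ h]
      ring
    · rw [← mul_assoc]
      exact hD.2
  · rw [indicator_of_notMem hD, symDiff, if_neg, mul_zero]
    rw [← mul_assoc]
    exact fun h => hD ⟨hx, h⟩

theorem aestronglyMeasurable_wt_mul_symDiff (k r : ℕ) {h : ℝ} (hh : 0 ≤ h) {F : ℝ → ℝ}
    (hF : AEStronglyMeasurable F mu) :
    AEStronglyMeasurable (fun x => wt (k * h) x ^ r * symDiff k (h * wphi x) F x) mu := by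
  refine AEStronglyMeasurable.congr ?_ (wt_mul_symDiff_ae_eq k r h F).symm
  rw [aestronglyMeasurable_indicator_iff (measurableSet_diffDom _), mu_restrict_diffDom]
  refine Finset.aestronglyMeasurable_fun_sum _ fun i hi => AEStronglyMeasurable.fun_const_smul ?_ _
  refine AEStronglyMeasurable.mul ?_
    (aestronglyMeasurable_comp_shift (abs_sub_half_mul_le hi hh) hF)
  have := measurable_wphi
  have : Measurable fun x => wt (k * h) x ^ r := by unfold wt; fun_prop
  exact this.aestronglyMeasurable

theorem sum_abs_choose_mul (k : ℕ) :
    ∑ i ∈ Finset.range (k + 1), |(k.choose i : ℝ) * (-1) ^ (k - i)| = 2 ^ k := by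
  have : ∀ i, |(k.choose i : ℝ) * (-1) ^ (k - i)| = k.choose i := by
    intro i; rw [abs_mul, abs_pow, abs_neg, abs_one, one_pow, mul_one, Nat.abs_cast]
  simp only [this]
  exact_mod_cast Nat.sum_range_choose k

theorem eLpNorm_fun_sum_le {ι : Type*} {s : Finset ι} {f : ι → ℝ → ℝ} {p : ℝ≥0∞} {ν : Measure ℝ}
    (hf : ∀ i ∈ s, AEStronglyMeasurable (f i) ν) (hp : 1 ≤ p) :
    eLpNorm (fun x => ∑ i ∈ s, f i x) p ν ≤ ∑ i ∈ s, eLpNorm (f i) p ν := by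
  rw [← Finset.sum_fn]
  exact eLpNorm_sum_le hf hp

/-- The weighted difference is bounded by the weighted norm, uniformly in `h`: each of the `k + 1`
terms is a shift, and `𝒲_{kh}` is at most `φ` at the shifted point. -/
theorem eLpNorm_wt_mul_symDiff_le {p : ℝ≥0∞} (hp : 1 ≤ p) (k r : ℕ) {h : ℝ} (hh : 0 ≤ h)
    {F : ℝ → ℝ} (hF : AEStronglyMeasurable F mu) :
    eLpNorm (fun x => wt (k * h) x ^ r * symDiff k (h * wphi x) F x) p mu ≤
      2 ^ (k + 1) * eLpNorm (fun x => F x * wphi x ^ r) p mu := by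
  have hG : AEStronglyMeasurable (fun x => F x * wphi x ^ r) mu :=
    hF.mul (measurable_wphi.pow_const r).aestronglyMeasurable
  rw [eLpNorm_congr_ae (wt_mul_symDiff_ae_eq k r h F),
    eLpNorm_indicator_eq_eLpNorm_restrict (measurableSet_diffDom _), mu_restrict_diffDom]
  set G : ℝ → ℝ := fun x => F x * wphi x ^ r with hGdef
  have hmeas : ∀ i ∈ Finset.range (k + 1), AEStronglyMeasurable
      (fun x => ((k.choose i : ℝ) * (-1) ^ (k - i)) • G (x + (((i : ℝ) - k / 2) * h) * wphi x))
      (volume.restrict (diffDom (k * h))) := fun i hi =>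
    (aestronglyMeasurable_comp_shift (abs_sub_half_mul_le hi hh) hG).fun_const_smul _
  calc _ ≤ eLpNorm (fun x => ∑ i ∈ Finset.range (k + 1),
          ‖((k.choose i : ℝ) * (-1) ^ (k - i)) • G (x + (((i : ℝ) - k / 2) * h) * wphi x)‖) p
          (volume.restrict (diffDom (k * h))) := by
        refine eLpNorm_mono_ae_real ?_
        filter_upwards [ae_restrict_mem (measurableSet_diffDom _)] with x hx
        refine (norm_sum_le _ _).trans (Finset.sum_le_sum fun i hi => ?_)
        rw [norm_smul, norm_smul]
        refine mul_le_mul_of_nonneg_left ?_ (norm_nonneg _)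
        simp only [hGdef]
        rw [norm_mul, norm_mul, mul_comm, norm_pow, norm_pow, Real.norm_of_nonneg (wt_nonneg _ _),
          Real.norm_of_nonneg (wphi_nonneg _)]
        have h1 := wt_le_wphi hx (abs_sub_half_mul_le hi hh)
        have h2 := wt_nonneg (k * h) x
        gcongr
    _ ≤ ∑ i ∈ Finset.range (k + 1), eLpNorm (fun x =>
          ‖((k.choose i : ℝ) * (-1) ^ (k - i)) • G (x + (((i : ℝ) - k / 2) * h) * wphi x)‖) p
          (volume.restrict (diffDom (k * h))) := by
        exact eLpNorm_fun_sum_le (fun i hi => (hmeas i hi).norm) hp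
    _ ≤ ∑ i ∈ Finset.range (k + 1), ENNReal.ofReal |(k.choose i : ℝ) * (-1) ^ (k - i)| *
          (2 * eLpNorm G p mu) := by
        refine Finset.sum_le_sum fun i hi => ?_
        rw [eLpNorm_norm, ← Real.norm_eq_abs, ofReal_norm]
        refine (eLpNorm_const_smul ((k.choose i : ℝ) * (-1) ^ (k - i))
          (fun x => G (x + (((i : ℝ) - k / 2) * h) * wphi x)) p _).trans_le ?_
        gcongr
        exact eLpNorm_comp_shift_le hp (abs_sub_half_mul_le hi hh) hG
    _ = _ := by
        rw [← Finset.sum_mul, ← ENNReal.ofReal_sum_of_nonneg fun _ _ => abs_nonneg _,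
          sum_abs_choose_mul, ENNReal.ofReal_pow zero_le_two, pow_succ, ENNReal.ofReal_ofNat]
        ring

/-! ### Differences of derivatives of polynomials -/

/-- The `l`-th moment of the `k`-th symmetric difference. -/
def diffMoment (k l : ℕ) : ℝ :=
  ∑ i ∈ Finset.range (k + 1), (k.choose i : ℝ) * (-1) ^ (k - i) * ((i : ℝ) - k / 2) ^ l

/-- The `k`-th difference annihilates polynomials of degree `< k`. -/
theorem diffMoment_eq_zero {k l : ℕ} (h : l < k) : diffMoment k l = 0 := by
  have h1 := congrFun (fwdDiff_iter_pow_eq_zero_of_lt (R := ℝ) h) (-(k : ℝ) / 2)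
  rw [fwdDiff_iter_eq_sum_shift] at h1
  simp only [Pi.zero_apply] at h1
  rw [diffMoment, ← h1]
  refine Finset.sum_congr rfl fun i _ => ?_
  rw [zsmul_eq_mul]
  push_cast
  rw [nsmul_eq_mul]
  ring

theorem abs_diffMoment_le (k l : ℕ) : |diffMoment k l| ≤ 2 ^ k * (k / 2 : ℝ) ^ l := by
  refine (Finset.abs_sum_le_sum_abs _ _).trans ?_
  rw [← sum_abs_choose_mul, Finset.sum_mul]
  refine Finset.sum_le_sum fun i hi => ?_
  rw [abs_mul, abs_pow]
  refine mul_le_mul_of_nonneg_left ?_ (abs_nonneg _)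
  have := abs_sub_half_mul_le hi zero_le_one
  rw [mul_one, mul_one] at this
  gcongr

/-- Taylor expansion of the difference of a polynomial at the centre `x`. -/
theorem symDiff_eval (k : ℕ) (η : ℝ) (Q : Polynomial ℝ) {N : ℕ} (hN : Q.natDegree < N) (x : ℝ) :
    symDiff k η (fun y => Q.eval y) x =
      if x - k * η / 2 ∈ Icc (-1 : ℝ) 1 ∧ x + k * η / 2 ∈ Icc (-1 : ℝ) 1 then
        ∑ l ∈ Finset.range N, (Polynomial.hasseDeriv l Q).eval x * η ^ l * diffMoment k l
      else 0 := by
  unfold symDiff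
  split_ifs with h
  · have h1 : ∀ y, Q.eval (x + y) =
        ∑ l ∈ Finset.range N, (Polynomial.hasseDeriv l Q).eval x * y ^ l := by
      intro y
      have h2 := Polynomial.taylor_eval x Q y
      rw [add_comm, ← h2, Polynomial.eval_eq_sum_range' (n := N)
        (by rwa [Polynomial.natDegree_taylor])]
      simp only [Polynomial.taylor_coeff]
    simp only [h1, Finset.mul_sum, diffMoment]
    rw [Finset.sum_comm]
    refine Finset.sum_congr rfl fun l _ => Finset.sum_congr rfl fun i _ => ?_
    rw [mul_pow]; ring
  · rfl

theorem symDiff_eval_eq_zero {k : ℕ} (η : ℝ) {Q : Polynomial ℝ} (hQ : Q.natDegree < k) (x : ℝ) :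
    symDiff k η (fun y => Q.eval y) x = 0 := by
  rw [symDiff_eval k η Q hQ]
  split_ifs
  · refine Finset.sum_eq_zero fun l hl => ?_
    rw [diffMoment_eq_zero (Finset.mem_range.1 hl), mul_zero]
  · rfl

theorem symDiff_add (k : ℕ) (η : ℝ) (F G : ℝ → ℝ) (x : ℝ) :
    symDiff k η (fun y => F y + G y) x = symDiff k η F x + symDiff k η G x := by
  unfold symDiff
  split_ifs
  · rw [← Finset.sum_add_distrib]
    exact Finset.sum_congr rfl fun i _ => by ring
  · rw [add_zero]

theorem iterate_derivative_eq_smul_hasseDeriv (r : ℕ) (Q : Polynomial ℝ) :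
    Polynomial.derivative^[r] Q = (r.factorial : ℝ) • Polynomial.hasseDeriv r Q := by
  rw [← Polynomial.factorial_smul_hasseDeriv, LinearMap.smul_apply, Nat.cast_smul_eq_nsmul]

theorem hasseDeriv_iterate_derivative (l r : ℕ) (Q : Polynomial ℝ) :
    Polynomial.hasseDeriv l (Polynomial.derivative^[r] Q) =
      ((r.factorial : ℝ) * (l + r).choose l) • Polynomial.hasseDeriv (l + r) Q := by
  rw [iterate_derivative_eq_smul_hasseDeriv, map_smul, mul_smul]
  congr 1
  have := LinearMap.congr_fun (Polynomial.hasseDeriv_comp (R := ℝ) l r) Q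
  rw [LinearMap.comp_apply, LinearMap.smul_apply] at this
  rw [this, Nat.cast_smul_eq_nsmul]

theorem eLpNorm_iterate_derivative_le {p : ℝ≥0∞} (hp : 1 ≤ p) (Q : Polynomial ℝ) {n : ℕ}
    (hn : 1 ≤ n) (hQ : Q.natDegree ≤ n) (r : ℕ) :
    eLpNorm (fun x => (Polynomial.derivative^[r] Q).eval x * wphi x ^ r) p mu ≤
      ENNReal.ofReal (r.factorial * (24 * (4 * n) ^ r)) * eLpNorm (fun x => Q.eval x) p mu := by
  have h1 : (fun x => (Polynomial.derivative^[r] Q).eval x * wphi x ^ r) =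
      (r.factorial : ℝ) • fun x => (Polynomial.hasseDeriv r Q).eval x * wphi x ^ r := by
    ext x
    rw [iterate_derivative_eq_smul_hasseDeriv, Polynomial.eval_smul, Pi.smul_apply, smul_eq_mul,
      smul_eq_mul, mul_assoc]
  rw [h1, eLpNorm_const_smul, ENNReal.ofReal_mul (by positivity), mul_assoc, ← ofReal_norm,
    Real.norm_of_nonneg (by positivity)]
  gcongr
  exact bernstein hp Q hn hQ r

theorem sum_Ico_pow_le {y : ℝ} (hy : 0 ≤ y) (hy2 : y ≤ 1 / 2) (k n : ℕ) :
    ∑ l ∈ Finset.Ico k n, y ^ l ≤ 2 * y ^ k := by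
  rw [Finset.sum_Ico_eq_sum_range]
  simp only [pow_add]
  rw [← Finset.mul_sum, mul_comm]
  refine mul_le_mul_of_nonneg_right ?_ (by positivity)
  calc ∑ i ∈ Finset.range (n - k), y ^ i ≤ ∑ i ∈ Finset.range (n - k), (1 / 2 : ℝ) ^ i := by gcongr
    _ ≤ 2 := sum_geometric_two_le _

theorem aestronglyMeasurable_eval (Q : Polynomial ℝ) :
    AEStronglyMeasurable (fun x => Q.eval x) mu :=
  (Polynomial.continuous Q).aestronglyMeasurable

/-- The constant of `eLpNorm_symDiff_polynomial_le`; its value is immaterial. -/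
def diffConst (k r : ℕ) : ℝ := 48 * r.factorial * 2 ^ (k + r) * 4 ^ r * (8 * k) ^ k

/-- The weighted difference of `Q^{(r)}` for a polynomial `Q` of degree at most `n`. If `h n` is
small, the Taylor terms of order `l ≥ k` are estimated by Bernstein's inequality and form a
geometric series in `4 k h n`; otherwise `h n` is bounded below and the bound for arbitrary
functions suffices. -/
theorem eLpNorm_symDiff_polynomial_le {p : ℝ≥0∞} (hp : 1 ≤ p) {k : ℕ} (hk : 1 ≤ k) (r : ℕ) {h : ℝ}
    (hh : 0 ≤ h) (Q : Polynomial ℝ) {n : ℕ} (hn : 1 ≤ n) (hQ : Q.natDegree ≤ n) :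
    eLpNorm (fun x => wt (k * h) x ^ r * symDiff k (h * wphi x)
        (fun y => (Polynomial.derivative^[r] Q).eval y) x) p mu ≤
      ENNReal.ofReal (diffConst k r * (h ^ k * n ^ (k + r))) *
        eLpNorm (fun x => Q.eval x) p mu := by
  have hn' : (1 : ℝ) ≤ n := by exact_mod_cast hn
  have hk' : (1 : ℝ) ≤ k := by exact_mod_cast hk
  have h24 : (1 : ℝ) ≤ 2 ^ r := one_le_pow₀ one_le_two
  rcases le_or_gt (4 * k * h * n) (1 / 2) with hs | hs
  · have hdeg : (Polynomial.derivative^[r] Q).natDegree < n + 1 :=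
      lt_of_le_of_lt ((Polynomial.natDegree_iterate_derivative _ _).trans (Nat.sub_le _ _))
        (by omega)
    set g : ℕ → ℝ → ℝ := fun l x => (2 ^ k * r.factorial * (l + r).choose l * (k / 2 * h) ^ l) •
      ((Polynomial.hasseDeriv (l + r) Q).eval x * wphi x ^ (l + r)) with hg
    have hgm : ∀ l, AEStronglyMeasurable (g l) mu := fun l =>
      ((aestronglyMeasurable_eval _).mul
        (measurable_wphi.pow_const _).aestronglyMeasurable).fun_const_smul _
    calc _ ≤ eLpNorm (fun x => ∑ l ∈ Finset.Ico k (n + 1), ‖g l x‖) p mu := by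
          refine eLpNorm_mono_ae_real ?_
          filter_upwards [ae_mem_Ioo] with x hx
          rw [symDiff_eval k _ _ hdeg]
          split_ifs with hD
          · have hxD : x ∈ diffDom (k * h) := ⟨hx, by rwa [← mul_assoc] at hD⟩
            have hw : wt (k * h) x ≤ wphi x := by
              have := wt_le_wphi (a := 0) hxD (by rw [abs_zero]; positivity)
              simpa using this
            have hw0 := wt_nonneg (k * h) x
            have hp0 := wphi_nonneg x
            rw [← Finset.sum_subset (s₁ := Finset.Ico k (n + 1)), norm_mul, norm_pow,
              Real.norm_of_nonneg hw0]
            · calc _ ≤ wphi x ^ r * ∑ l ∈ Finset.Ico k (n + 1),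
                    ‖(Polynomial.hasseDeriv l (Polynomial.derivative^[r] Q)).eval x *
                      (h * wphi x) ^ l * diffMoment k l‖ := by
                    gcongr
                    exact norm_sum_le _ _
                _ ≤ _ := by
                    rw [Finset.mul_sum]
                    refine Finset.sum_le_sum fun l _ => ?_
                    rw [hasseDeriv_iterate_derivative, Polynomial.eval_smul]
                    simp only [hg, norm_mul, norm_smul, norm_pow, Real.norm_of_nonneg hh,
                      Real.norm_of_nonneg hp0, Real.norm_natCast, Real.norm_ofNat, norm_div]
                    calc _ ≤ wphi x ^ r * (r.factorial * (l + r).choose l *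
                          ‖(Polynomial.hasseDeriv (l + r) Q).eval x‖ * (h * wphi x) ^ l *
                          (2 ^ k * (k / 2 : ℝ) ^ l)) := by
                          gcongr
                          exact abs_diffMoment_le k l
                      _ = _ := by rw [mul_pow, mul_pow, pow_add]; ring
            · intro l hl
              rw [Finset.mem_Ico] at hl
              exact Finset.mem_range.2 hl.2
            · intro l hl hl'
              rw [Finset.mem_range] at hl
              rw [Finset.mem_Ico, not_and_or, not_le] at hl'
              rw [diffMoment_eq_zero (by omega), mul_zero]
          · rw [mul_zero, norm_zero]
            exact Finset.sum_nonneg fun _ _ => norm_nonneg _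
      _ ≤ ∑ l ∈ Finset.Ico k (n + 1), eLpNorm (fun x => ‖g l x‖) p mu := by
          exact eLpNorm_fun_sum_le (fun l _ => (hgm l).norm) hp
      _ ≤ ∑ l ∈ Finset.Ico k (n + 1), ENNReal.ofReal
          ((24 * 2 ^ k * r.factorial * 2 ^ r * (4 * n) ^ r) * (4 * k * h * n) ^ l) *
          eLpNorm (fun x => Q.eval x) p mu := by
          refine Finset.sum_le_sum fun l _ => ?_
          rw [eLpNorm_norm]
          refine (eLpNorm_const_smul (2 ^ k * r.factorial * (l + r).choose l * (k / 2 * h) ^ l : ℝ)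
            (fun x => (Polynomial.hasseDeriv (l + r) Q).eval x * wphi x ^ (l + r)) p _).trans_le ?_
          refine (mul_le_mul_right (bernstein hp Q hn hQ (l + r)) _).trans ?_
          rw [← ofReal_norm, Real.norm_of_nonneg (by positivity), ← mul_assoc,
            ← ENNReal.ofReal_mul (by positivity)]
          refine mul_le_mul_left (ENNReal.ofReal_le_ofReal ?_) _
          have hch : ((l + r).choose l : ℝ) ≤ 2 ^ (l + r) := by
            exact_mod_cast Nat.choose_le_two_pow _ _
          calc _ ≤ 2 ^ k * r.factorial * 2 ^ (l + r) * (k / 2 * h) ^ l *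
                (24 * (4 * n) ^ (l + r)) := by gcongr
            _ = _ := by
                simp only [mul_pow, pow_add, div_pow]
                field_simp
      _ ≤ _ := by
          rw [← Finset.sum_mul, ← ENNReal.ofReal_sum_of_nonneg fun _ _ => by positivity,
            ← Finset.mul_sum]
          refine mul_le_mul_left (ENNReal.ofReal_le_ofReal ?_) _
          calc _ ≤ (24 * 2 ^ k * r.factorial * 2 ^ r * (4 * n) ^ r) * (2 * (4 * k * h * n) ^ k) := by
                gcongr
                exact sum_Ico_pow_le (by positivity) hs _ _
            _ ≤ (24 * 2 ^ k * r.factorial * 2 ^ r * (4 * n) ^ r) * (2 * (8 * k * h * n) ^ k) := by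
                gcongr
                norm_num
            _ = _ := by rw [diffConst]; simp only [mul_pow, pow_add]; ring
  · refine (eLpNorm_wt_mul_symDiff_le hp k r hh (aestronglyMeasurable_eval _)).trans ?_
    refine (mul_le_mul_right (eLpNorm_iterate_derivative_le hp Q hn hQ r) _).trans ?_
    have h2 : (2 : ℝ≥0∞) ^ (k + 1) = ENNReal.ofReal (2 ^ (k + 1)) := by
      rw [ENNReal.ofReal_pow zero_le_two, ENNReal.ofReal_ofNat]
    rw [h2, ← mul_assoc, ← ENNReal.ofReal_mul (by positivity)]
    refine mul_le_mul_left (ENNReal.ofReal_le_ofReal ?_) _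
    have h1 : (1 : ℝ) ≤ (8 * k * h * n) ^ k := one_le_pow₀ (by linarith)
    calc _ = (48 * 2 ^ k * r.factorial * 4 ^ r * n ^ r * 1 * 1 : ℝ) := by
          rw [mul_pow, pow_succ]; ring
      _ ≤ 48 * 2 ^ k * r.factorial * 4 ^ r * n ^ r * 2 ^ r * (8 * k * h * n) ^ k := by gcongr
      _ = _ := by rw [diffConst]; simp only [mul_pow, pow_add]; ring

/-! ### Near-best approximants and local bounds -/

instance : IsFiniteMeasure mu := by unfold mu; infer_instance

theorem memLp_eval (Q : Polynomial ℝ) (p : ℝ≥0∞) : MemLp (fun x => Q.eval x) p mu := by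
  obtain ⟨C, hC⟩ := isCompact_Icc.exists_bound_of_continuousOn
    (Polynomial.continuous Q).continuousOn (s := Icc (-1 : ℝ) 1)
  refine MemLp.of_bound (aestronglyMeasurable_eval Q) C ?_
  exact (ae_restrict_iff' measurableSet_Icc).2 (Eventually.of_forall hC)

theorem memLp_eval_mul_wphi (Q : Polynomial ℝ) (i : ℕ) (p : ℝ≥0∞) :
    MemLp (fun x => Q.eval x * wphi x ^ i) p mu := by
  refine (memLp_eval Q p).mono ((aestronglyMeasurable_eval Q).mul
    (measurable_wphi.pow_const i).aestronglyMeasurable) (Eventually.of_forall fun x => ?_)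
  rw [norm_mul, norm_pow, Real.norm_of_nonneg (wphi_nonneg x)]
  refine mul_le_of_le_one_right (norm_nonneg _) (pow_le_one₀ (wphi_nonneg x) ?_)
  rw [wphi, Real.sqrt_le_one]
  nlinarith [sq_nonneg x]

theorem bestApprox_le_eLpNorm (n : ℕ) (p : ℝ≥0∞) (f : ℝ → ℝ) :
    bestApprox n p f ≤ eLpNorm f p mu := by
  refine (iInf₂_le 0 (Submodule.zero_mem _)).trans ?_
  simp

/-- Existence of near-best approximants, up to a factor `2`. When `E_n(f)_p = 0` this says that `f`
is almost everywhere a polynomial of degree `< n`, because a finite-dimensional subspace of `L_p` is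
closed. -/
theorem exists_eLpNorm_sub_le_two_mul_bestApprox {p : ℝ≥0∞} (hp : 1 ≤ p) {f : ℝ → ℝ}
    (hf : MemLp f p mu) (n : ℕ) :
    ∃ P ∈ Polynomial.degreeLT ℝ n,
      eLpNorm (fun x => f x - P.eval x) p mu ≤ 2 * bestApprox n p f := by
  have : Fact (1 ≤ p) := ⟨hp⟩
  have hfin : bestApprox n p f ≠ ∞ := ((bestApprox_le_eLpNorm n p f).trans_lt hf.2).ne
  by_cases h0 : bestApprox n p f = 0
  · let T : Polynomial ℝ →ₗ[ℝ] Lp ℝ p mu :=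
      { toFun := fun P => (memLp_eval P p).toLp
        map_add' := fun P Q => by
          rw [← MemLp.toLp_add]
          congr 1
          ext x
          simp
        map_smul' := fun c P => by
          rw [RingHom.id_apply, ← MemLp.toLp_const_smul]
          congr 1
          ext x
          simp }
    have hT : ∀ P, T P = (memLp_eval P p).toLp := fun _ => rfl
    have : FiniteDimensional ℝ (Polynomial.degreeLT ℝ n) :=
      Module.Finite.equiv (Polynomial.degreeLTEquiv ℝ n).symm
    have hcl : IsClosed ((Polynomial.degreeLT ℝ n).map T : Set (Lp ℝ p mu)) :=
      Submodule.closed_of_finiteDimensional _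
    have hmem : hf.toLp ∈ closure ((Polynomial.degreeLT ℝ n).map T : Set (Lp ℝ p mu)) := by
      rw [EMetric.mem_closure_iff]
      intro ε hε
      rw [← h0] at hε
      obtain ⟨P, hP⟩ := iInf_lt_iff.1 hε
      obtain ⟨hP, hlt⟩ := iInf_lt_iff.1 hP
      refine ⟨T P, ⟨P, hP, rfl⟩, ?_⟩
      rw [hT, Lp.edist_toLp_toLp]
      exact hlt
    rw [hcl.closure_eq] at hmem
    obtain ⟨P, hP, hPf⟩ := hmem
    refine ⟨P, hP, ?_⟩
    have h1 := Lp.edist_toLp_toLp f (fun x => P.eval x) hf (memLp_eval P p)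
    rw [← hT, hPf, edist_self] at h1
    change eLpNorm (f - fun x => P.eval x) p mu ≤ _
    rw [← h1]
    exact zero_le
  · have hlt : bestApprox n p f < 2 * bestApprox n p f := by
      rw [two_mul]
      exact ENNReal.lt_add_right hfin h0
    obtain ⟨P, hP⟩ := iInf_lt_iff.1 hlt
    obtain ⟨hP, hlt⟩ := iInf_lt_iff.1 hP
    exact ⟨P, hP, hlt.le⟩

/-- On compact subintervals of `(-1, 1)` the `L_1` norm is controlled by the weighted `L_p` norm. -/
theorem exists_lintegral_Icc_le {p : ℝ≥0∞} (hp : 1 ≤ p) {a b : ℝ} (ha : -1 < a) (hb : b < 1)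
    (i : ℕ) : ∃ C : ℝ≥0∞, C ≠ ∞ ∧ ∀ F : ℝ → ℝ, AEStronglyMeasurable F mu →
      ∫⁻ x in Icc a b, ‖F x‖ₑ ≤ C * eLpNorm (fun x => F x * wphi x ^ i) p mu := by
  set c := Real.sqrt ((1 - b) * (1 + a)) with hc
  have hc0 : 0 < c := Real.sqrt_pos.2 (mul_pos (by linarith) (by linarith))
  have hcw : ∀ x ∈ Icc a b, c ≤ wphi x := by
    intro x hx
    refine Real.sqrt_le_sqrt ?_
    have : 1 - x ^ 2 = (1 - x) * (1 + x) := by ring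
    rw [this]
    exact mul_le_mul (by linarith [hx.2]) (by linarith [hx.1]) (by linarith) (by linarith [hx.2])
  refine ⟨ENNReal.ofReal ((c ^ i)⁻¹) * mu univ ^ (1 / (1 : ℝ≥0∞).toReal - 1 / p.toReal), ?_,
    fun F hF => ?_⟩
  · refine ENNReal.mul_ne_top ENNReal.ofReal_ne_top (ENNReal.rpow_ne_top_of_nonneg ?_
      (measure_ne_top _ _))
    rw [ENNReal.toReal_one, sub_nonneg]
    by_cases hpt : p = ∞
    · simp [hpt]
    · have : 1 ≤ p.toReal := by rw [← ENNReal.toReal_one]; exact ENNReal.toReal_mono hpt hp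
      rw [one_div_one, div_le_one (by linarith)]
      exact this
  · have hm : AEStronglyMeasurable (fun x => F x * wphi x ^ i) mu :=
      hF.mul (measurable_wphi.pow_const i).aestronglyMeasurable
    calc ∫⁻ x in Icc a b, ‖F x‖ₑ
        ≤ ∫⁻ x in Icc a b, ENNReal.ofReal ((c ^ i)⁻¹) * ‖F x * wphi x ^ i‖ₑ := by
          refine setLIntegral_mono' measurableSet_Icc fun x hx => ?_
          rw [← ofReal_norm, ← ofReal_norm, ← ENNReal.ofReal_mul (by positivity)]
          refine ENNReal.ofReal_le_ofReal ?_
          rw [norm_mul, norm_pow, Real.norm_of_nonneg (wphi_nonneg x), ← div_eq_inv_mul,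
            le_div_iff₀ (by positivity)]
          have := hcw x hx
          gcongr
      _ = ENNReal.ofReal ((c ^ i)⁻¹) * ∫⁻ x in Icc a b, ‖F x * wphi x ^ i‖ₑ :=
          lintegral_const_mul' _ _ ENNReal.ofReal_ne_top
      _ ≤ ENNReal.ofReal ((c ^ i)⁻¹) * eLpNorm (fun x => F x * wphi x ^ i) 1 mu := by
          rw [eLpNorm_one_eq_lintegral_enorm, mu]
          gcongr
      _ ≤ _ := by
          rw [mul_assoc, mul_comm (mu univ ^ _)]
          gcongr
          exact eLpNorm_le_eLpNorm_mul_rpow_measure_univ hp hm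

theorem enorm_intervalIntegral_le {F : ℝ → ℝ} {a b x y : ℝ} (hx : x ∈ Icc a b) (hy : y ∈ Icc a b) :
    ‖∫ t in x..y, F t‖ₑ ≤ ∫⁻ t in Icc a b, ‖F t‖ₑ := by
  rw [intervalIntegral.intervalIntegral_eq_integral_uIoc, enorm_smul]
  have h1 : ‖(if x ≤ y then (1 : ℝ) else -1)‖ₑ = 1 := by split_ifs <;> simp
  rw [h1, one_mul]
  refine (enorm_integral_le_lintegral_enorm _).trans (lintegral_mono_set ?_)
  exact uIoc_subset_uIcc.trans (ordConnected_Icc.uIcc_subset hx hy)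

/-- A one-dimensional Sobolev inequality, for polynomials. -/
theorem enorm_eval_le_lintegral (q : Polynomial ℝ) {a b x : ℝ} (hx : x ∈ Icc a b) :
    ENNReal.ofReal (b - a) * ‖q.eval x‖ₑ ≤ (∫⁻ y in Icc a b, ‖q.eval y‖ₑ) +
      ENNReal.ofReal (b - a) * ∫⁻ y in Icc a b, ‖q.derivative.eval y‖ₑ := by
  have h1 : ∀ y ∈ Icc a b, ‖q.eval x‖ₑ ≤ ‖q.eval y‖ₑ + ∫⁻ y in Icc a b, ‖q.derivative.eval y‖ₑ := by
    intro y hy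
    have h2 : ∫ t in y..x, q.derivative.eval t = q.eval x - q.eval y :=
      intervalIntegral.integral_eq_sub_of_hasDerivAt (fun t _ => q.hasDerivAt t)
        ((Polynomial.continuous _).intervalIntegrable _ _)
    have h3 : q.eval x = q.eval y + ∫ t in y..x, q.derivative.eval t := by rw [h2]; ring
    rw [h3]
    exact (enorm_add_le _ _).trans (add_le_add le_rfl (enorm_intervalIntegral_le hy hx))
  have h4 := setLIntegral_mono' (μ := volume) measurableSet_Icc h1
  rw [setLIntegral_const, Real.volume_Icc, lintegral_add_right _ measurable_const,
    setLIntegral_const, Real.volume_Icc] at h4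
  rw [mul_comm, mul_comm (ENNReal.ofReal (b - a)) (∫⁻ y in Icc a b, ‖q.derivative.eval y‖ₑ)]
  exact h4

/-- The weighted form of the Sobolev inequality, with the constant independent of the polynomial. -/
theorem exists_enorm_eval_le {p : ℝ≥0∞} (hp : 1 ≤ p) {a b : ℝ} (ha : -1 < a) (hab : a < b)
    (hb : b < 1) (i : ℕ) : ∃ C : ℝ≥0∞, C ≠ ∞ ∧ ∀ q : Polynomial ℝ, ∀ x ∈ Icc a b,
      ‖q.eval x‖ₑ ≤ C * (eLpNorm (fun x => q.eval x * wphi x ^ i) p mu +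
        eLpNorm (fun x => q.derivative.eval x * wphi x ^ (i + 1)) p mu) := by
  obtain ⟨C1, hC1, h1⟩ := exists_lintegral_Icc_le hp ha hb i
  obtain ⟨C2, hC2, h2⟩ := exists_lintegral_Icc_le hp ha hb (i + 1)
  set L := ENNReal.ofReal (b - a) with hL
  have hL0 : L ≠ 0 := by rw [hL, Ne, ENNReal.ofReal_eq_zero, not_le]; linarith
  have hLt : L ≠ ∞ := ENNReal.ofReal_ne_top
  refine ⟨L⁻¹ * C1 + C2,
    ENNReal.add_ne_top.2 ⟨ENNReal.mul_ne_top (ENNReal.inv_ne_top.2 hL0) hC1, hC2⟩,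
    fun q x hx => ?_⟩
  have h3 := enorm_eval_le_lintegral q hx
  have h4 : ‖q.eval x‖ₑ ≤ L⁻¹ * (∫⁻ y in Icc a b, ‖q.eval y‖ₑ) +
      ∫⁻ y in Icc a b, ‖q.derivative.eval y‖ₑ := by
    have := mul_le_mul_right h3 L⁻¹
    rwa [← mul_assoc, mul_add, ← mul_assoc, ENNReal.inv_mul_cancel hL0 hLt, one_mul,
      one_mul] at this
  refine h4.trans ?_
  rw [add_mul, mul_assoc]
  refine add_le_add ?_ ?_
  · refine mul_le_mul_right ((h1 _ (aestronglyMeasurable_eval q)).trans ?_) _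
    exact mul_le_mul_right le_self_add _
  · refine (h2 _ (aestronglyMeasurable_eval _)).trans ?_
    exact mul_le_mul_right le_add_self _

/-! ### Limits of rapidly converging polynomials -/

/-- The pointwise limit of the `i`-th derivatives of a sequence of polynomials, with an arbitrary
value where the limit does not exist. -/
def derivLim (P : ℕ → Polynomial ℝ) (i : ℕ) (x : ℝ) : ℝ :=
  limUnder atTop fun j => (Polynomial.derivative^[i] (P j)).eval x

/-- The weighted norm `‖φ^i (P_{j+1} - P_j)^{(i)}‖_p`. -/
def stepNorm (p : ℝ≥0∞) (P : ℕ → Polynomial ℝ) (i j : ℕ) : ℝ≥0∞ :=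
  eLpNorm (fun x => (Polynomial.derivative^[i] (P (j + 1) - P j)).eval x * wphi x ^ i) p mu

section limit

variable {p : ℝ≥0∞} {P : ℕ → Polynomial ℝ} {s : ℕ}

/-- On compact subintervals of `(-1, 1)` the derivatives of order at most `s` have summable steps in
the uniform norm. The Sobolev inequality costs one derivative, whence the range `i ≤ s + 1` in the
hypothesis. -/
theorem exists_edist_eval_le (hp : 1 ≤ p) (hsum : ∀ i ≤ s + 1, ∑' j, stepNorm p P i j ≠ ∞)
    {i : ℕ} (hi : i ≤ s) {a b : ℝ} (ha : -1 < a) (hab : a < b) (hb : b < 1) :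
    ∃ d : ℕ → ℝ≥0∞, ∑' j, d j ≠ ∞ ∧ ∀ j, ∀ x ∈ Icc a b,
      edist ((Polynomial.derivative^[i] (P j)).eval x)
        ((Polynomial.derivative^[i] (P (j + 1))).eval x) ≤ d j := by
  obtain ⟨C, hC, h⟩ := exists_enorm_eval_le hp ha hab hb i
  refine ⟨fun j => C * (stepNorm p P i j + stepNorm p P (i + 1) j), ?_, fun j x hx => ?_⟩
  · rw [ENNReal.tsum_mul_left, ENNReal.tsum_add]
    exact ENNReal.mul_ne_top hC (ENNReal.add_ne_top.2 ⟨hsum i (by omega), hsum (i + 1) (by omega)⟩)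
  · have h1 := h (Polynomial.derivative^[i] (P (j + 1) - P j)) x hx
    rw [edist_comm, edist_eq_enorm_sub, ← Polynomial.eval_sub, ← Polynomial.iterate_derivative_sub]
    rw [← Function.iterate_succ_apply' Polynomial.derivative i] at h1
    exact h1

theorem exists_Icc_mem_nhds {x : ℝ} (hx : x ∈ Ioo (-1 : ℝ) 1) :
    ∃ a b : ℝ, -1 < a ∧ a < b ∧ b < 1 ∧ Icc a b ∈ 𝓝 x :=
  ⟨(x - 1) / 2, (x + 1) / 2, by linarith [hx.1], by linarith, by linarith [hx.2],
    Icc_mem_nhds (by linarith [hx.1]) (by linarith [hx.2])⟩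

theorem tendsto_derivLim (hp : 1 ≤ p) (hsum : ∀ i ≤ s + 1, ∑' j, stepNorm p P i j ≠ ∞)
    {i : ℕ} (hi : i ≤ s) {x : ℝ} (hx : x ∈ Ioo (-1 : ℝ) 1) :
    Tendsto (fun j => (Polynomial.derivative^[i] (P j)).eval x) atTop (𝓝 (derivLim P i x)) := by
  obtain ⟨a, b, ha, hab, hb, hmem⟩ := exists_Icc_mem_nhds hx
  obtain ⟨d, hd, h⟩ := exists_edist_eval_le hp hsum hi ha hab hb
  exact (cauchySeq_of_edist_le_of_tsum_ne_top d
    (fun j => h j x (mem_of_mem_nhds hmem)) hd).tendsto_limUnder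

theorem tendstoLocallyUniformlyOn_derivLim (hp : 1 ≤ p)
    (hsum : ∀ i ≤ s + 1, ∑' j, stepNorm p P i j ≠ ∞) {i : ℕ} (hi : i ≤ s) :
    TendstoLocallyUniformlyOn (fun j x => (Polynomial.derivative^[i] (P j)).eval x)
      (derivLim P i) atTop (Ioo (-1) 1) := by
  rw [EMetric.tendstoLocallyUniformlyOn_iff]
  intro ε hε x hx
  obtain ⟨a, b, ha, hab, hb, hmem⟩ := exists_Icc_mem_nhds hx
  obtain ⟨d, hd, h⟩ := exists_edist_eval_le hp hsum hi ha hab hb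
  refine ⟨Icc a b, mem_nhdsWithin_of_mem_nhds hmem, ?_⟩
  filter_upwards [(ENNReal.tendsto_sum_nat_add d hd).eventually (gt_mem_nhds hε)] with n hn y hy
  rw [edist_comm]
  refine (edist_le_tsum_of_edist_le_of_tendsto d (fun j => h j y hy) (tendsto_derivLim hp hsum hi
    ⟨ha.trans_le hy.1, hy.2.trans_lt hb⟩) n).trans_lt ?_
  simpa only [add_comm n] using hn

theorem hasDerivAt_derivLim (hp : 1 ≤ p) (hsum : ∀ i ≤ s + 1, ∑' j, stepNorm p P i j ≠ ∞)
    {i : ℕ} (hi : i < s) {x : ℝ} (hx : x ∈ Ioo (-1 : ℝ) 1) :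
    HasDerivAt (derivLim P i) (derivLim P (i + 1) x) x := by
  refine hasDerivAt_of_tendstoLocallyUniformlyOn isOpen_Ioo
    (tendstoLocallyUniformlyOn_derivLim hp hsum (i := i + 1) hi)
    (Eventually.of_forall fun j y _ => ?_) (fun y hy => tendsto_derivLim hp hsum hi.le hy) hx
  rw [Function.iterate_succ_apply']
  exact Polynomial.hasDerivAt _ y

theorem iteratedDeriv_derivLim (hp : 1 ≤ p) (hsum : ∀ i ≤ s + 1, ∑' j, stepNorm p P i j ≠ ∞)
    {i : ℕ} (hi : i ≤ s) {x : ℝ} (hx : x ∈ Ioo (-1 : ℝ) 1) :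
    iteratedDeriv i (derivLim P 0) x = derivLim P i x := by
  induction i generalizing x with
  | zero => rw [iteratedDeriv_zero]
  | succ i ih =>
    rw [iteratedDeriv_succ, ← (hasDerivAt_derivLim hp hsum (i := i) hi hx).deriv]
    refine Filter.EventuallyEq.deriv_eq ?_
    filter_upwards [isOpen_Ioo.mem_nhds hx] with y hy
    exact ih (by omega) hy

theorem contDiffOn_derivLim (hp : 1 ≤ p) (hsum : ∀ i ≤ s + 1, ∑' j, stepNorm p P i j ≠ ∞)
    (n : ℕ) {i : ℕ} (hi : n + i ≤ s) : ContDiffOn ℝ n (derivLim P i) (Ioo (-1) 1) := by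
  induction n generalizing i with
  | zero =>
    refine contDiffOn_zero.2 ?_
    refine (tendstoLocallyUniformlyOn_derivLim hp hsum (i := i) (by omega)).continuousOn
      (Frequently.of_forall fun j => (Polynomial.continuous _).continuousOn)
  | succ n ih =>
    rw [Nat.cast_succ, contDiffOn_succ_iff_deriv_of_isOpen isOpen_Ioo]
    refine ⟨fun x hx =>
        (hasDerivAt_derivLim hp hsum (by omega) hx).differentiableAt.differentiableWithinAt,
      fun h => absurd h (by simp), (ih (i := i + 1) (by omega)).congr fun x hx => ?_⟩
    exact (hasDerivAt_derivLim hp hsum (by omega) hx).deriv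

theorem iterate_derivative_eval_mul_sub (i : ℕ) (Q R : Polynomial ℝ) (x : ℝ) :
    (Polynomial.derivative^[i] (Q - R)).eval x * wphi x ^ i =
      (Polynomial.derivative^[i] Q).eval x * wphi x ^ i -
        (Polynomial.derivative^[i] R).eval x * wphi x ^ i := by
  rw [Polynomial.iterate_derivative_sub, Polynomial.eval_sub, sub_mul]

/-- The limit `G` of the derivatives of order `r` in `L_p` with weight `φ ^ r`, and the rate of
convergence. -/
theorem exists_weighted_limit (hp : 1 ≤ p) {r : ℕ} (hsum : ∑' j, stepNorm p P r j ≠ ∞) :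
    ∃ G : ℝ → ℝ, AEStronglyMeasurable G mu ∧ MemLp (fun x => G x * wphi x ^ r) p mu ∧
      ∀ M, eLpNorm (fun x => (G x - (Polynomial.derivative^[r] (P M)).eval x) * wphi x ^ r) p mu ≤
        ∑' j, stepNorm p P r (M + j) := by
  have : Fact (1 ≤ p) := ⟨hp⟩
  set u : ℕ → Lp ℝ p mu := fun j =>
    (memLp_eval_mul_wphi (Polynomial.derivative^[r] (P j)) r p).toLp with hu
  have hstep : ∀ j, edist (u j) (u (j + 1)) ≤ stepNorm p P r j := by
    intro j
    rw [edist_comm, hu, Lp.edist_toLp_toLp]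
    refine le_of_eq (congrArg (fun f => eLpNorm f p mu) (funext fun x => ?_))
    exact (iterate_derivative_eval_mul_sub r _ _ x).symm
  obtain ⟨U, hU⟩ := cauchySeq_tendsto_of_complete
    (cauchySeq_of_edist_le_of_tsum_ne_top (stepNorm p P r) hstep hsum)
  have hGU : ∀ᵐ x ∂mu, U x / wphi x ^ r * wphi x ^ r = U x := by
    filter_upwards [ae_mem_Ioo] with x hx
    exact div_mul_cancel₀ _ (pow_ne_zero _ (wphi_pos hx).ne')
  refine ⟨fun x => U x / wphi x ^ r, ?_, (memLp_congr_ae hGU).2 (Lp.memLp U), fun M => ?_⟩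
  · exact ((Lp.aestronglyMeasurable U).aemeasurable.div
      (measurable_wphi.pow_const r).aemeasurable).aestronglyMeasurable
  · have h := edist_le_tsum_of_edist_le_of_tendsto (stepNorm p P r) hstep hU M
    rw [edist_comm, Lp.edist_def] at h
    refine le_trans (le_of_eq (eLpNorm_congr_ae ?_)) h
    filter_upwards [hGU,
      MemLp.coeFn_toLp (memLp_eval_mul_wphi (Polynomial.derivative^[r] (P M)) r p)]
      with x h1 h2
    rw [sub_mul, h1, Pi.sub_apply, hu, h2]

theorem integrableOn_Icc_of_weighted (hp : 1 ≤ p) {r : ℕ} {G : ℝ → ℝ}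
    (hG : AEStronglyMeasurable G mu) (hGp : MemLp (fun x => G x * wphi x ^ r) p mu) {a b : ℝ}
    (ha : -1 < a) (hb : b < 1) : IntegrableOn G (Icc a b) := by
  obtain ⟨C, hC, h⟩ := exists_lintegral_Icc_le hp ha hb r
  refine ⟨hG.mono_measure (Measure.restrict_mono_set _ (Icc_subset_Icc ha.le hb.le)), ?_⟩
  exact (h G hG).trans_lt (ENNReal.mul_lt_top hC.lt_top hGp.2)

/-- The limit of the derivatives of order `s` is a primitive of the weighted limit `G` of those of
order `s + 1`. -/
theorem derivLim_sub_eq_integral (hp : 1 ≤ p) (hsum : ∀ i ≤ s + 1, ∑' j, stepNorm p P i j ≠ ∞)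
    {G : ℝ → ℝ} (hG : AEStronglyMeasurable G mu)
    (hGp : MemLp (fun x => G x * wphi x ^ (s + 1)) p mu)
    (hlim : ∀ M, eLpNorm (fun x => (G x - (Polynomial.derivative^[s + 1] (P M)).eval x) *
      wphi x ^ (s + 1)) p mu ≤ ∑' j, stepNorm p P (s + 1) (M + j))
    {a b x y : ℝ} (ha : -1 < a) (hb : b < 1) (hx : x ∈ Icc a b) (hy : y ∈ Icc a b) :
    derivLim P s y - derivLim P s x = ∫ t in x..y, G t := by
  obtain ⟨C, hC, h⟩ := exists_lintegral_Icc_le hp ha hb (s + 1)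
  have hio : ∀ z ∈ Icc a b, z ∈ Ioo (-1 : ℝ) 1 := fun z hz => ⟨ha.trans_le hz.1, hz.2.trans_lt hb⟩
  have hGi : IntervalIntegrable G volume x y :=
    ((integrableOn_Icc_of_weighted hp hG hGp ha hb).mono_set
      (ordConnected_Icc.uIcc_subset hx hy)).intervalIntegrable
  have h1 : Tendsto (fun j => (Polynomial.derivative^[s] (P j)).eval y -
      (Polynomial.derivative^[s] (P j)).eval x) atTop (𝓝 (derivLim P s y - derivLim P s x)) :=
    (tendsto_derivLim hp hsum le_rfl (hio y hy)).sub (tendsto_derivLim hp hsum le_rfl (hio x hx))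
  refine tendsto_nhds_unique h1 ?_
  rw [tendsto_iff_edist_tendsto_0]
  have h2 : Tendsto (fun j => C * ∑' m, stepNorm p P (s + 1) (m + j)) atTop (𝓝 0) := by
    have := ENNReal.Tendsto.const_mul (a := C)
      (ENNReal.tendsto_sum_nat_add _ (hsum (s + 1) le_rfl)) (Or.inr hC)
    rwa [mul_zero] at this
  refine tendsto_of_tendsto_of_tendsto_of_le_of_le tendsto_const_nhds h2 (fun _ => zero_le)
    fun j => ?_
  have h3 : ∫ t in x..y, (Polynomial.derivative^[s + 1] (P j)).eval t =
      (Polynomial.derivative^[s] (P j)).eval y - (Polynomial.derivative^[s] (P j)).eval x := by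
    refine intervalIntegral.integral_eq_sub_of_hasDerivAt
      (f := fun t => (Polynomial.derivative^[s] (P j)).eval t) (fun t _ => ?_)
      ((Polynomial.continuous _).intervalIntegrable _ _)
    rw [Function.iterate_succ_apply']
    exact Polynomial.hasDerivAt _ t
  simp only
  rw [← h3, edist_comm, edist_eq_enorm_sub, ← intervalIntegral.integral_sub hGi
    ((Polynomial.continuous _).intervalIntegrable _ _)]
  refine (enorm_intervalIntegral_le hx hy).trans ?_
  refine (h _ (hG.sub (aestronglyMeasurable_eval _))).trans ?_
  refine mul_le_mul_right ?_ C
  simp only [add_comm _ j]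
  exact hlim j

theorem absolutelyContinuousOnInterval_of_dist_eq {F H : ℝ → ℝ} {a b : ℝ}
    (h : ∀ x ∈ uIcc a b, ∀ y ∈ uIcc a b, dist (F x) (F y) = dist (H x) (H y))
    (hH : AbsolutelyContinuousOnInterval H a b) : AbsolutelyContinuousOnInterval F a b := by
  rw [absolutelyContinuousOnInterval_iff] at hH ⊢
  intro ε hε
  obtain ⟨δ, hδ, hE⟩ := hH ε hε
  refine ⟨δ, hδ, fun E hEm hlt => ?_⟩
  rw [Finset.sum_congr rfl fun i hi => h _ (hEm.1 i hi).1 _ (hEm.1 i hi).2]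
  exact hE E hEm hlt

/-- Exhaustion of `(-1, 1)` by countably many subintervals with endpoints inside. -/
theorem ae_mu_of_forall_Icc {q : ℝ → Prop}
    (h : ∀ a b : ℝ, -1 < a → a < b → b < 1 → ∀ᵐ x, x ∈ Ioo a b → q x) : ∀ᵐ x ∂mu, q x := by
  have h1 : ∀ n : ℕ, ∀ᵐ x, x ∈ Ioo (-1 + 1 / ((n : ℝ) + 2)) (1 - 1 / ((n : ℝ) + 2)) → q x := by
    intro n
    by_cases hn : -1 + 1 / ((n : ℝ) + 2) < 1 - 1 / ((n : ℝ) + 2)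
    · have : 0 < 1 / ((n : ℝ) + 2) := by positivity
      exact h _ _ (by linarith) hn (by linarith)
    · rw [Ioo_eq_empty hn]
      exact Eventually.of_forall fun x hx => absurd hx (notMem_empty x)
  have h2 : ∀ᵐ x ∂mu, ∀ n : ℕ,
      x ∈ Ioo (-1 + 1 / ((n : ℝ) + 2)) (1 - 1 / ((n : ℝ) + 2)) → q x :=
    ae_all_iff.2 fun n => ae_restrict_of_ae (h1 n)
  filter_upwards [h2, ae_mem_Ioo] with x hx hx1
  obtain ⟨n, hn⟩ := exists_nat_one_div_lt (lt_min (by linarith [hx1.1] : 0 < x + 1)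
    (by linarith [hx1.2] : 0 < 1 - x))
  have h3 : 1 / ((n : ℝ) + 2) ≤ 1 / ((n : ℝ) + 1) := by gcongr; norm_num
  refine hx n ⟨?_, ?_⟩
  · linarith [hn.trans_le (min_le_left _ _)]
  · linarith [hn.trans_le (min_le_right _ _)]

/-- If the polynomials `P j` tend to `f` in `L_p` and their derivatives up to order `s + 1` have
summable weighted steps, then `f` has a representative in `𝔹_p^{s+1}`, and its derivative of order
`s + 1` is approximated by those of the `P j` at the rate given by the tails of the series. -/
theorem exists_memB_of_summable (hp : 1 ≤ p) {f : ℝ → ℝ} (hf : MemLp f p mu)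
    (hfP : Tendsto (fun j => eLpNorm (fun x => f x - (P j).eval x) p mu) atTop (𝓝 0))
    (hsum : ∀ i ≤ s + 1, ∑' j, stepNorm p P i j ≠ ∞) :
    ∃ g : ℝ → ℝ, g =ᵐ[mu] f ∧ MemB p (s + 1) g ∧
      AEStronglyMeasurable (iteratedDeriv (s + 1) g) mu ∧
      ∀ M, eLpNorm (fun x => (iteratedDeriv (s + 1) g x -
        (Polynomial.derivative^[s + 1] (P M)).eval x) * wphi x ^ (s + 1)) p mu ≤
          ∑' j, stepNorm p P (s + 1) (M + j) := by
  obtain ⟨G, hG, hGp, hlim⟩ := exists_weighted_limit hp (hsum (s + 1) le_rfl)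
  have hint : ∀ a b x y : ℝ, -1 < a → b < 1 → x ∈ Icc a b → y ∈ Icc a b →
      derivLim P s y - derivLim P s x = ∫ t in x..y, G t := fun a b x y ha hb hx hy =>
    derivLim_sub_eq_integral hp hsum hG hGp hlim ha hb hx hy
  have hGi : ∀ a b : ℝ, -1 < a → a ≤ b → b < 1 → IntervalIntegrable G volume a b := by
    intro a b ha hab hb
    refine IntegrableOn.intervalIntegrable ?_
    rw [uIcc_of_le hab]
    exact integrableOn_Icc_of_weighted hp hG hGp ha hb
  -- Lebesgue's differentiation theorem, since the `s`-th derivative is a primitive of `G`.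
  have hderiv : iteratedDeriv (s + 1) (derivLim P 0) =ᵐ[mu] G := by
    refine ae_mu_of_forall_Icc fun a b ha hab hb => ?_
    filter_upwards [(hGi a b ha hab.le hb).ae_hasDerivAt_integral] with x hx hxab
    rw [uIcc_of_le hab.le] at hx
    have h1 := hx (Ioo_subset_Icc_self hxab) a (left_mem_Icc.2 hab.le)
    rw [iteratedDeriv_succ, ← (h1.const_add (derivLim P s a)).deriv]
    refine Filter.EventuallyEq.deriv_eq ?_
    filter_upwards [isOpen_Ioo.mem_nhds hxab] with y hy
    rw [iteratedDeriv_derivLim hp hsum le_rfl ⟨ha.trans hy.1, hy.2.trans hb⟩,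
      ← hint a b a y ha hb (left_mem_Icc.2 hab.le) (Ioo_subset_Icc_self hy)]
    ring
  refine ⟨derivLim P 0, ?_, ⟨contDiffOn_derivLim hp hsum s le_rfl, fun a b ha hab hb => ?_, ?_⟩,
    hG.congr hderiv.symm, fun M => ?_⟩
  -- A subsequence of the `P j` tends to `f` almost everywhere, and it tends to `derivLim P 0` in
  -- `(-1, 1)`.
  · have hm : TendstoInMeasure mu (fun j x => (P j).eval x) atTop f := by
      refine tendstoInMeasure_of_tendsto_eLpNorm (p := p) (zero_lt_one.trans_le hp).ne'
        (fun j => aestronglyMeasurable_eval _) hf.1 (hfP.congr fun j => ?_)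
      rw [← eLpNorm_neg]
      congr 1
      ext x
      simp
    obtain ⟨ns, hns, hae⟩ := hm.exists_seq_tendsto_ae
    filter_upwards [hae, ae_mem_Ioo] with x hx hx1
    exact tendsto_nhds_unique
      ((tendsto_derivLim hp hsum (Nat.zero_le s) hx1).comp hns.tendsto_atTop) hx
  · refine absolutelyContinuousOnInterval_of_dist_eq (fun x hx y hy => ?_)
      ((hGi a b ha hab hb).absolutelyContinuousOnInterval_intervalIntegral left_mem_uIcc)
    rw [uIcc_of_le hab] at hx hy
    rw [iteratedDeriv_derivLim hp hsum le_rfl ⟨ha.trans_le hx.1, hx.2.trans_lt hb⟩,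
      iteratedDeriv_derivLim hp hsum le_rfl ⟨ha.trans_le hy.1, hy.2.trans_lt hb⟩,
      ← hint a b a x ha hb (left_mem_Icc.2 hab) hx, ← hint a b a y ha hb (left_mem_Icc.2 hab) hy,
      dist_sub_right]
  · refine (memLp_congr_ae ?_).2 hGp
    filter_upwards [hderiv] with x hx
    rw [hx]
  · refine le_trans (le_of_eq (eLpNorm_congr_ae ?_)) (hlim M)
    filter_upwards [hderiv] with x hx
    rw [hx]

end limit

/-! ### Dyadic sums -/

/-- The dyadic term `2^{js} ϕ(2^{-j})`. -/
def dyadTerm (ϕ : ℝ → ℝ) (s j : ℕ) : ℝ≥0∞ := ENNReal.ofReal ((2 ^ j) ^ s * ϕ ((1 / 2) ^ j))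

section phi

variable {ϕ : ℝ → ℝ}

theorem half_pow_mem (j : ℕ) : (1 / 2 : ℝ) ^ j ∈ Icc (0 : ℝ) 1 :=
  ⟨by positivity, pow_le_one₀ (by norm_num) (by norm_num)⟩

/-- On `(x, 2x]` the integrand is at least `ϕ(x) / (2x)^{s+1}` by monotonicity, and the interval has
length `x`. -/
theorem ofReal_le_phiInt (hϕ : IsPhi ϕ) (s : ℕ) {x : ℝ} (hx : 0 < x) (hx1 : 2 * x ≤ 1) :
    ENNReal.ofReal ((x ^ s)⁻¹ * ϕ x) ≤ 2 ^ (s + 1) * phiInt ϕ 1 s x (2 * x) := by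
  have hxm : x ∈ Icc (0 : ℝ) 1 := ⟨hx.le, by linarith⟩
  have hϕx := hϕ.nonneg x hxm
  have h1 : ∫⁻ _ in Ioc x (2 * x), ENNReal.ofReal (ϕ x / (2 * x) ^ (s + 1)) ≤
      phiInt ϕ 1 s x (2 * x) := by
    refine setLIntegral_mono' measurableSet_Ioc fun u hu => ENNReal.ofReal_le_ofReal ?_
    rw [one_mul]
    have hum : u ∈ Icc (0 : ℝ) 1 := ⟨hx.le.trans hu.1.le, hu.2.trans hx1⟩
    have h2 := hϕ.mono hxm hum hu.1.le
    have h3 := hx.trans hu.1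
    gcongr
    · exact hϕx.trans h2
    · exact hu.2
  rw [setLIntegral_const, Real.volume_Ioc, ← ENNReal.ofReal_mul (by positivity)] at h1
  calc _ = 2 ^ (s + 1) * ENNReal.ofReal (ϕ x / (2 * x) ^ (s + 1) * (2 * x - x)) := by
        have h2 : (2 : ℝ≥0∞) ^ (s + 1) = ENNReal.ofReal (2 ^ (s + 1)) := by
          rw [ENNReal.ofReal_pow zero_le_two, ENNReal.ofReal_ofNat]
        rw [h2, ← ENNReal.ofReal_mul (by positivity)]
        congr 1
        rw [mul_pow, pow_succ x]
        field_simp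
        ring
    _ ≤ _ := by gcongr

theorem dyadTerm_succ_le (hϕ : IsPhi ϕ) (s i : ℕ) :
    dyadTerm ϕ s (i + 1) ≤ 2 ^ (s + 1) * phiInt ϕ 1 s ((1 / 2) ^ (i + 1)) ((1 / 2) ^ i) := by
  have h2 : 2 * (1 / 2 : ℝ) ^ (i + 1) = (1 / 2) ^ i := by rw [pow_succ]; ring
  have h := ofReal_le_phiInt hϕ s (x := (1 / 2) ^ (i + 1)) (by positivity)
    (by rw [h2]; exact (half_pow_mem i).2)
  rw [h2] at h
  refine le_trans (le_of_eq ?_) h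
  rw [dyadTerm, one_div, inv_pow, inv_pow, inv_inv]

theorem pairwise_disjoint_dyadic :
    Pairwise (Function.onFun Disjoint fun i : ℕ => Ioc ((1 / 2 : ℝ) ^ (i + 1)) ((1 / 2) ^ i)) :=
  (pow_right_anti₀ (by norm_num : (0 : ℝ) ≤ 1 / 2) (by norm_num)).pairwise_disjoint_on_Ioc_succ

/-- The index starts at `1`, since `ϕ(1)` is not controlled by the integral of `ϕ` over `(0, 1]`. -/
theorem sum_dyadTerm_le (hϕ : IsPhi ϕ) (s : ℕ) {J : ℕ} {t : ℝ} (ht : t ≤ (1 / 2) ^ J) :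
    ∑ i ∈ Finset.range J, dyadTerm ϕ s (i + 1) ≤ 2 ^ (s + 1) * phiInt ϕ 1 s t 1 := by
  refine (Finset.sum_le_sum fun i _ => dyadTerm_succ_le hϕ s i).trans ?_
  rw [← Finset.mul_sum]
  refine mul_le_mul_right ?_ _
  unfold phiInt
  rw [← lintegral_biUnion_finset (fun i _ j _ hij => pairwise_disjoint_dyadic hij)
    fun _ _ => measurableSet_Ioc]
  refine lintegral_mono_set (iUnion₂_subset fun i hi => Ioc_subset_Ioc ?_ (half_pow_mem i).2)
  exact ht.trans (pow_le_pow_of_le_one (by norm_num) (by norm_num) (Finset.mem_range.1 hi))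

theorem tsum_dyadTerm_le (hϕ : IsPhi ϕ) (s : ℕ) {M : ℕ} {t : ℝ} (ht : (1 / 2) ^ M ≤ t) :
    ∑' i, dyadTerm ϕ s (M + i + 1) ≤ 2 ^ (s + 1) * phiInt ϕ 1 s 0 t := by
  refine (ENNReal.tsum_le_tsum fun i => dyadTerm_succ_le hϕ s (M + i)).trans ?_
  rw [ENNReal.tsum_mul_left]
  refine mul_le_mul_right ?_ _
  unfold phiInt
  have hd : Pairwise (Function.onFun Disjoint
      fun i : ℕ => Ioc ((1 / 2 : ℝ) ^ (M + i + 1)) ((1 / 2) ^ (M + i))) := fun i j hij =>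
    pairwise_disjoint_dyadic (fun h : M + i = M + j => hij (Nat.add_left_cancel h))
  rw [← lintegral_iUnion (fun _ => measurableSet_Ioc) hd]
  refine lintegral_mono_set (iUnion_subset fun i => Ioc_subset_Ioc (by positivity) ?_)
  exact (pow_le_pow_of_le_one (by norm_num) (by norm_num) (Nat.le_add_right M i)).trans ht

/-- Passage from the integral without the factor `m` to the one with it, for `m ≥ 1`. -/
theorem phiInt_one_le (hϕ : IsPhi ϕ) {m : ℝ} (hm : 1 ≤ m) (s : ℕ) {a b : ℝ} (ha : 0 ≤ a)
    (hb : b ≤ 1) :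
    phiInt ϕ 1 s a b ≤ phiInt ϕ m s a b := by
  refine setLIntegral_mono' measurableSet_Ioc fun u hu => ENNReal.ofReal_le_ofReal ?_
  have h0 : 0 ≤ u := ha.trans hu.1.le
  have := hϕ.nonneg u ⟨h0, hu.2.trans hb⟩
  gcongr

theorem dyadTerm_succ_le_mul (hϕ : IsPhi ϕ) (s j : ℕ) :
    dyadTerm ϕ s (j + 1) ≤ 2 ^ s * dyadTerm ϕ s j := by
  have h2 : (2 : ℝ≥0∞) ^ s = ENNReal.ofReal (2 ^ s) := by
    rw [ENNReal.ofReal_pow zero_le_two, ENNReal.ofReal_ofNat]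
  rw [dyadTerm, dyadTerm, h2, ← ENNReal.ofReal_mul (by positivity)]
  refine ENNReal.ofReal_le_ofReal ?_
  rw [pow_succ, mul_pow, mul_comm ((2 ^ j) ^ s : ℝ), mul_assoc]
  have := hϕ.mono (half_pow_mem (j + 1)) (half_pow_mem j)
    (pow_le_pow_of_le_one (by norm_num) (by norm_num) (Nat.le_succ j))
  gcongr

theorem dyadTerm_mono_exponent (hϕ : IsPhi ϕ) {i r : ℕ} (h : i ≤ r) (j : ℕ) :
    dyadTerm ϕ i j ≤ dyadTerm ϕ r j := by
  refine ENNReal.ofReal_le_ofReal ?_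
  have := hϕ.nonneg _ (half_pow_mem j)
  have h1 : (1 : ℝ) ≤ 2 ^ j := one_le_pow₀ one_le_two
  gcongr

theorem dyadTerm_eq (ϕ : ℝ → ℝ) (s j : ℕ) :
    dyadTerm ϕ s j = ENNReal.ofReal ((2 ^ j) ^ s) * dyadTerm ϕ 0 j := by
  rw [dyadTerm, dyadTerm, ← ENNReal.ofReal_mul (by positivity), pow_zero, one_mul]

theorem tendsto_dyadTerm_zero (hϕ : IsPhi ϕ) : Tendsto (dyadTerm ϕ 0) atTop (𝓝 0) := by
  have h1 : Tendsto (fun j : ℕ => (1 / 2 : ℝ) ^ j) atTop (𝓝[>] 0) :=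
    tendsto_nhdsWithin_iff.2 ⟨tendsto_pow_atTop_nhds_zero_of_lt_one (by norm_num) (by norm_num),
      Eventually.of_forall fun j => by rw [mem_Ioi]; positivity⟩
  have h2 := ENNReal.tendsto_ofReal (hϕ.tendsto_zero.comp h1)
  rw [ENNReal.ofReal_zero] at h2
  refine h2.congr fun j => ?_
  rw [dyadTerm, pow_zero, one_mul, Function.comp_apply]

end phi

/-! ### Telescoping -/

/-- The weighted norm of a `k`-th difference with step `h φ`. -/
def diffNorm (k r : ℕ) (p : ℝ≥0∞) (h : ℝ) (F : ℝ → ℝ) : ℝ≥0∞ :=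
  eLpNorm (fun x => wt (k * h) x ^ r * symDiff k (h * wphi x) F x) p mu

theorem diffNorm_add_le {p : ℝ≥0∞} (hp : 1 ≤ p) (k r : ℕ) {h : ℝ} (hh : 0 ≤ h) {F G : ℝ → ℝ}
    (hF : AEStronglyMeasurable F mu) (hG : AEStronglyMeasurable G mu) :
    diffNorm k r p h (fun x => F x + G x) ≤ diffNorm k r p h F + diffNorm k r p h G := by
  refine le_trans (le_of_eq ?_) (eLpNorm_add_le (aestronglyMeasurable_wt_mul_symDiff k r hh hF)
    (aestronglyMeasurable_wt_mul_symDiff k r hh hG) hp)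
  unfold diffNorm
  congr 1
  ext x
  rw [symDiff_add, mul_add, Pi.add_apply]

theorem diffNorm_polynomial_le_add {p : ℝ≥0∞} (hp : 1 ≤ p) (k r : ℕ) {h : ℝ} (hh : 0 ≤ h)
    (Q R : Polynomial ℝ) :
    diffNorm k r p h (fun x => (Polynomial.derivative^[r] Q).eval x) ≤
      diffNorm k r p h (fun x => (Polynomial.derivative^[r] (Q - R)).eval x) +
        diffNorm k r p h (fun x => (Polynomial.derivative^[r] R).eval x) := by
  refine le_trans (le_of_eq ?_) (diffNorm_add_le hp k r hh (aestronglyMeasurable_eval _)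
    (aestronglyMeasurable_eval _))
  congr 1
  ext x
  rw [Polynomial.iterate_derivative_sub, Polynomial.eval_sub, sub_add_cancel]

theorem diffNorm_eq_zero_of_degree {p : ℝ≥0∞} {k r : ℕ} (h : ℝ) {Q : Polynomial ℝ}
    (hk : 1 ≤ k) (hQ : Q ∈ Polynomial.degreeLT ℝ (k + r)) :
    diffNorm k r p h (fun x => (Polynomial.derivative^[r] Q).eval x) = 0 := by
  have hdeg : (Polynomial.derivative^[r] Q).natDegree < k := by
    have h1 : Q.natDegree < k + r := by
      by_cases h0 : Q = 0
      · rw [h0, Polynomial.natDegree_zero]; omega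
      · exact (Polynomial.natDegree_lt_iff_degree_lt h0).2 (Polynomial.mem_degreeLT.1 hQ)
    have h2 := Polynomial.natDegree_iterate_derivative Q r
    omega
  unfold diffNorm
  simp only [symDiff_eval_eq_zero _ hdeg, mul_zero]
  exact eLpNorm_zero'

theorem natDegree_le_of_mem_degreeLT {Q : Polynomial ℝ} {n : ℕ} (hQ : Q ∈ Polynomial.degreeLT ℝ n) :
    Q.natDegree ≤ n :=
  Polynomial.natDegree_le_of_degree_le (Polynomial.mem_degreeLT.1 hQ).le

theorem bestApprox_anti {m n : ℕ} (h : m ≤ n) (p : ℝ≥0∞) (f : ℝ → ℝ) :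
    bestApprox n p f ≤ bestApprox m p f :=
  biInf_mono (fun _ hP => Polynomial.degreeLT_mono h hP)

theorem eLpNorm_eval_sub_le {p : ℝ≥0∞} (hp : 1 ≤ p) {f : ℝ → ℝ} (hf : MemLp f p mu)
    (Q R : Polynomial ℝ) :
    eLpNorm (fun x => (Q - R).eval x) p mu ≤
      eLpNorm (fun x => f x - Q.eval x) p mu + eLpNorm (fun x => f x - R.eval x) p mu := by
  have h := eLpNorm_sub_le (μ := mu) (f := fun x => f x - R.eval x) (g := fun x => f x - Q.eval x)
    (hf.1.sub (aestronglyMeasurable_eval R)) (hf.1.sub (aestronglyMeasurable_eval Q)) hp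
  rw [add_comm]
  refine le_trans (le_of_eq ?_) h
  congr 1
  ext x
  rw [Pi.sub_apply, Polynomial.eval_sub]
  ring

/-- Decompose `F` as `(F - P_M^{(r)}) + ∑ (P_{j+1} - P_j)^{(r)} + (P_m - R)^{(r)} + R^{(r)}`. The
bound for arbitrary functions is applied to the first term, that for polynomials to the others, and
the difference of `R^{(r)}` is zero because `R^{(r)}` has degree `< k`. -/
theorem diffNorm_le_telescope {p : ℝ≥0∞} (hp : 1 ≤ p) {k : ℕ} (hk : 1 ≤ k) (r : ℕ) {h : ℝ}
    (hh : 0 ≤ h) {F : ℝ → ℝ} (hF : AEStronglyMeasurable F mu) {P : ℕ → Polynomial ℝ}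
    (hP : ∀ j, P j ∈ Polynomial.degreeLT ℝ (2 ^ j)) {R : Polynomial ℝ}
    (hR : R ∈ Polynomial.degreeLT ℝ (k + r)) {m M : ℕ} (hm : k + r ≤ 2 ^ m) (hmM : m ≤ M) :
    diffNorm k r p h F ≤
      2 ^ (k + 1) * eLpNorm (fun x => (F x - (Polynomial.derivative^[r] (P M)).eval x) * wphi x ^ r)
        p mu +
      (∑ j ∈ Finset.Ico m M, ENNReal.ofReal (diffConst k r * (h ^ k * (2 ^ (j + 1)) ^ (k + r))) *
        eLpNorm (fun x => (P (j + 1) - P j).eval x) p mu) +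
      ENNReal.ofReal (diffConst k r * (h ^ k * (2 ^ m) ^ (k + r))) *
        eLpNorm (fun x => (P m - R).eval x) p mu := by
  have hpoly : ∀ (Q : Polynomial ℝ) (j : ℕ), Q ∈ Polynomial.degreeLT ℝ (2 ^ j) →
      diffNorm k r p h (fun x => (Polynomial.derivative^[r] Q).eval x) ≤
        ENNReal.ofReal (diffConst k r * (h ^ k * (2 ^ j) ^ (k + r))) *
          eLpNorm (fun x => Q.eval x) p mu := by
    intro Q j hQ
    have := eLpNorm_symDiff_polynomial_le hp hk r hh Q (n := 2 ^ j) Nat.one_le_two_pow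
      (natDegree_le_of_mem_degreeLT hQ)
    push_cast at this
    exact this
  have h1 : diffNorm k r p h F ≤
      diffNorm k r p h (fun x => F x - (Polynomial.derivative^[r] (P M)).eval x) +
        diffNorm k r p h (fun x => (Polynomial.derivative^[r] (P M)).eval x) := by
    refine le_trans (le_of_eq ?_) (diffNorm_add_le hp k r hh (hF.sub (aestronglyMeasurable_eval _))
      (aestronglyMeasurable_eval _))
    congr 1
    ext x
    simp
  have h2 : ∀ M, m ≤ M → diffNorm k r p h (fun x => (Polynomial.derivative^[r] (P M)).eval x) ≤
      (∑ j ∈ Finset.Ico m M, ENNReal.ofReal (diffConst k r * (h ^ k * (2 ^ (j + 1)) ^ (k + r))) *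
        eLpNorm (fun x => (P (j + 1) - P j).eval x) p mu) +
      ENNReal.ofReal (diffConst k r * (h ^ k * (2 ^ m) ^ (k + r))) *
        eLpNorm (fun x => (P m - R).eval x) p mu := by
    intro M hM
    induction M, hM using Nat.le_induction with
    | base =>
      rw [Finset.Ico_self, Finset.sum_empty, zero_add]
      refine (diffNorm_polynomial_le_add hp k r hh (P m) R).trans ?_
      rw [diffNorm_eq_zero_of_degree h hk hR, add_zero]
      exact hpoly _ _ (Submodule.sub_mem _ (hP m) (Polynomial.degreeLT_mono hm hR))
    | succ M hM ih =>
      refine (diffNorm_polynomial_le_add hp k r hh (P (M + 1)) (P M)).trans ?_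
      rw [Finset.sum_Ico_succ_top hM, add_comm (∑ j ∈ Finset.Ico m M, _), add_assoc]
      refine add_le_add (hpoly _ _ (Submodule.sub_mem _ (hP (M + 1))
        (Polynomial.degreeLT_mono (Nat.pow_le_pow_right two_pos (Nat.le_succ M)) (hP M)))) ih
  refine h1.trans ?_
  rw [add_assoc]
  refine add_le_add ?_ (h2 M hmM)
  exact eLpNorm_wt_mul_symDiff_le hp k r hh (hF.sub (aestronglyMeasurable_eval _))

/-! ### The estimate of the modulus -/

theorem dyadTerm_zero_anti {ϕ : ℝ → ℝ} (hϕ : IsPhi ϕ) {i j : ℕ} (h : i ≤ j) :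
    dyadTerm ϕ 0 j ≤ dyadTerm ϕ 0 i := by
  rw [dyadTerm, dyadTerm, pow_zero, pow_zero, one_mul, one_mul]
  exact ENNReal.ofReal_le_ofReal (hϕ.mono (half_pow_mem j) (half_pow_mem i)
    (pow_le_pow_of_le_one (by norm_num) (by norm_num) h))

theorem bestApprox_two_pow_le {p : ℝ≥0∞} {ϕ f : ℝ → ℝ} {N : ℕ}
    (hE : ∀ n : ℕ, N ≤ n → bestApprox n p f ≤ ENNReal.ofReal (ϕ (1 / (n : ℝ)))) {j : ℕ}
    (hj : N ≤ 2 ^ j) : bestApprox (2 ^ j) p f ≤ dyadTerm ϕ 0 j := by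
  refine (hE _ hj).trans (le_of_eq ?_)
  rw [dyadTerm, pow_zero, one_mul, one_div_pow]
  push_cast
  rfl

/-- A sequence of near-best approximants of `f` of degree `< 2^j`, whose errors and steps are
controlled by `ϕ` from the index `m` on. -/
structure IsNearBest (p : ℝ≥0∞) (ϕ f : ℝ → ℝ) (m : ℕ) (P : ℕ → Polynomial ℝ) : Prop where
  mem : ∀ j, P j ∈ Polynomial.degreeLT ℝ (2 ^ j)
  near : ∀ j, eLpNorm (fun x => f x - (P j).eval x) p mu ≤ 2 * bestApprox (2 ^ j) p f
  near_phi : ∀ j, m ≤ j → eLpNorm (fun x => f x - (P j).eval x) p mu ≤ 2 * dyadTerm ϕ 0 j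
  step : ∀ j, m ≤ j → eLpNorm (fun x => (P (j + 1) - P j).eval x) p mu ≤ 4 * dyadTerm ϕ 0 j

theorem exists_isNearBest {p : ℝ≥0∞} (hp : 1 ≤ p) {ϕ f : ℝ → ℝ} (hϕ : IsPhi ϕ)
    (hf : MemLp f p mu) {N m : ℕ}
    (hE : ∀ n : ℕ, N ≤ n → bestApprox n p f ≤ ENNReal.ofReal (ϕ (1 / (n : ℝ))))
    (hN : N ≤ 2 ^ m) : ∃ P, IsNearBest p ϕ f m P := by
  choose P hP hPf using fun j : ℕ => exists_eLpNorm_sub_le_two_mul_bestApprox hp hf (2 ^ j)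
  have h1 : ∀ j, m ≤ j → eLpNorm (fun x => f x - (P j).eval x) p mu ≤ 2 * dyadTerm ϕ 0 j :=
    fun j hj => (hPf j).trans (mul_le_mul_right (bestApprox_two_pow_le hE
      (hN.trans (Nat.pow_le_pow_right two_pos hj))) _)
  refine ⟨P, hP, hPf, h1, fun j hj => ?_⟩
  refine (eLpNorm_eval_sub_le hp hf _ _).trans ?_
  calc _ ≤ 2 * dyadTerm ϕ 0 (j + 1) + 2 * dyadTerm ϕ 0 j :=
        add_le_add (h1 _ (by omega)) (h1 _ hj)
    _ ≤ 2 * dyadTerm ϕ 0 j + 2 * dyadTerm ϕ 0 j := by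
        gcongr
        exact dyadTerm_zero_anti hϕ (Nat.le_succ j)
    _ = _ := by ring

/-- The constant in the contribution of the steps `P (j + 1) - P j`, see `sum_step_le`. -/
def middleConst (k r : ℕ) : ℝ≥0∞ :=
  ENNReal.ofReal (diffConst k r * 2 ^ (k + r)) * 4 * ((1 + 2 ^ (k + r)) * 2 ^ (k + r + 1))

theorem diffConst_nonneg (k r : ℕ) : 0 ≤ diffConst k r := by unfold diffConst; positivity

/-- The last index in the sum may be `J + 1`, one more than `sum_dyadTerm_le` allows; that term is
absorbed by its predecessor. -/
theorem sum_Ico_dyadTerm_le {ϕ : ℝ → ℝ} (hϕ : IsPhi ϕ) (s : ℕ) {m J : ℕ} (hm : 1 ≤ m) (hJ : 1 ≤ J)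
    {t : ℝ} (ht : t ≤ (1 / 2) ^ J) :
    ∑ j ∈ Finset.Ico m (max m (J + 2)), dyadTerm ϕ s j ≤
      (1 + 2 ^ s) * 2 ^ (s + 1) * phiInt ϕ 1 s t 1 := by
  have h1 : ∑ j ∈ Finset.Ico m (max m (J + 2)), dyadTerm ϕ s j ≤
      ∑ j ∈ Finset.Ico 1 (J + 2), dyadTerm ϕ s j := by
    refine Finset.sum_le_sum_of_subset fun j hj => ?_
    rw [Finset.mem_Ico] at hj ⊢
    omega
  have h2 : ∑ j ∈ Finset.Ico 1 (J + 2), dyadTerm ϕ s j =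
      ∑ i ∈ Finset.range J, dyadTerm ϕ s (i + 1) + dyadTerm ϕ s (J + 1) := by
    rw [Finset.sum_Ico_eq_sum_range, show J + 2 - 1 = J + 1 by omega, Finset.sum_range_succ]
    simp only [add_comm 1]
  have h3 : dyadTerm ϕ s J ≤ ∑ i ∈ Finset.range J, dyadTerm ϕ s (i + 1) := by
    have := Finset.single_le_sum (f := fun i => dyadTerm ϕ s (i + 1)) (fun _ _ => zero_le)
      (Finset.mem_range.2 (show J - 1 < J by omega))
    simpa only [Nat.sub_add_cancel hJ] using this
  calc _ ≤ _ := h1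
    _ = _ := h2
    _ ≤ ∑ i ∈ Finset.range J, dyadTerm ϕ s (i + 1) +
        2 ^ s * ∑ i ∈ Finset.range J, dyadTerm ϕ s (i + 1) := by
        gcongr
        exact (dyadTerm_succ_le_mul hϕ s J).trans (mul_le_mul_right h3 _)
    _ = (1 + 2 ^ s) * ∑ i ∈ Finset.range J, dyadTerm ϕ s (i + 1) := by ring
    _ ≤ _ := by
        rw [mul_assoc]
        exact mul_le_mul_right (sum_dyadTerm_le hϕ s ht) _

theorem sum_step_le {p : ℝ≥0∞} {ϕ f : ℝ → ℝ} (hϕ : IsPhi ϕ) {m : ℕ} {P : ℕ → Polynomial ℝ}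
    (hP : IsNearBest p ϕ f m P) (k r : ℕ) {J : ℕ} (hm : 1 ≤ m) (hJ : 1 ≤ J)
    {h t : ℝ} (hh : 0 ≤ h) (hht : h ≤ t) (ht : t ≤ (1 / 2) ^ J) :
    (∑ j ∈ Finset.Ico m (max m (J + 2)),
      ENNReal.ofReal (diffConst k r * (h ^ k * (2 ^ (j + 1)) ^ (k + r))) *
        eLpNorm (fun x => (P (j + 1) - P j).eval x) p mu) ≤
      middleConst k r * ENNReal.ofReal (t ^ k) * phiInt ϕ 1 (k + r) t 1 := by
  have hD := diffConst_nonneg k r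
  have ht0 := hh.trans hht
  calc _ ≤ ∑ j ∈ Finset.Ico m (max m (J + 2)),
        ENNReal.ofReal (diffConst k r * 2 ^ (k + r)) * 4 * ENNReal.ofReal (t ^ k) *
          dyadTerm ϕ (k + r) j := by
        refine Finset.sum_le_sum fun j hj => ?_
        refine (mul_le_mul_right (hP.step j (Finset.mem_Ico.1 hj).1) _).trans ?_
        rw [dyadTerm_eq ϕ (k + r) j]
        calc _ ≤ ENNReal.ofReal (diffConst k r * 2 ^ (k + r) * t ^ k * (2 ^ j) ^ (k + r)) *
              (4 * dyadTerm ϕ 0 j) := by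
              refine mul_le_mul_left (ENNReal.ofReal_le_ofReal ?_) _
              calc _ ≤ diffConst k r * (t ^ k * (2 ^ (j + 1)) ^ (k + r)) := by gcongr
                _ = _ := by rw [pow_succ, mul_pow]; ring
          _ = _ := by
              rw [ENNReal.ofReal_mul (by positivity), ENNReal.ofReal_mul (by positivity)]
              ring
    _ = ENNReal.ofReal (diffConst k r * 2 ^ (k + r)) * 4 * ENNReal.ofReal (t ^ k) *
          ∑ j ∈ Finset.Ico m (max m (J + 2)), dyadTerm ϕ (k + r) j := by rw [Finset.mul_sum]
    _ ≤ ENNReal.ofReal (diffConst k r * 2 ^ (k + r)) * 4 * ENNReal.ofReal (t ^ k) *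
          ((1 + 2 ^ (k + r)) * 2 ^ (k + r + 1) * phiInt ϕ 1 (k + r) t 1) :=
        mul_le_mul_right (sum_Ico_dyadTerm_le hϕ (k + r) hm hJ ht) _
    _ = _ := by rw [middleConst]; ring

theorem symDiff_zero_step {k : ℕ} (hk : 1 ≤ k) (F : ℝ → ℝ) (x : ℝ) : symDiff k 0 F x = 0 := by
  have h := diffMoment_eq_zero (show 0 < k by omega)
  simp only [diffMoment, pow_zero, mul_one] at h
  simp only [symDiff, mul_zero, add_zero]
  rw [← Finset.sum_mul, h, zero_mul, ite_self]

/-- At `t = 0` only `h = 0` occurs, and the difference with step `0` is `F(x) (1 - 1)^k`. -/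
theorem modulus_zero {k : ℕ} (hk : 1 ≤ k) (r : ℕ) (p : ℝ≥0∞) (F : ℝ → ℝ) :
    modulus k r p F 0 = 0 := by
  refine le_antisymm (iSup₂_le fun h hh => ?_) zero_le
  rw [Icc_self, mem_singleton_iff] at hh
  simp only [hh, zero_mul, symDiff_zero_step hk, mul_zero]
  exact eLpNorm_zero'.le

/-- The factor of `t^k E_{k+r}(f)` when the telescoping sum starts at `P m`. -/
def startConst (k r m : ℕ) : ℝ≥0∞ := ENNReal.ofReal (diffConst k r * (2 ^ m) ^ (k + r)) * 4

/-- The modulus of `F` at `t`, given that on the dyadic range `(2^{-J-1}, 2^{-J}]` of `t` the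
derivative of order `r` of `P (max m (J + 2))` approximates `F` with an error of the right order. -/
theorem modulus_le {p : ℝ≥0∞} (hp : 1 ≤ p) {k : ℕ} (hk : 1 ≤ k) (r : ℕ) {ϕ f : ℝ → ℝ}
    (hϕ : IsPhi ϕ) (hf : MemLp f p mu) {m : ℕ} {P : ℕ → Polynomial ℝ}
    (hP : IsNearBest p ϕ f m P) (hm : 1 ≤ m) (hkr : k + r ≤ 2 ^ m) {F : ℝ → ℝ}
    (hF : AEStronglyMeasurable F mu) {K : ℝ≥0∞}
    (hrem : ∀ (J : ℕ) (t : ℝ), 1 ≤ J → (1 / 2) ^ (J + 1) < t → t ≤ (1 / 2) ^ J →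
      eLpNorm (fun x => (F x - (Polynomial.derivative^[r] (P (max m (J + 2)))).eval x) * wphi x ^ r)
        p mu ≤ K * (phiInt ϕ r r 0 t + ENNReal.ofReal (t ^ k) * phiInt ϕ 1 (k + r) t 1))
    {t : ℝ} (ht : t ∈ Icc (0 : ℝ) (1 / 2)) :
    modulus k r p F t ≤ (2 ^ (k + 1) * K + middleConst k r) * phiInt ϕ r r 0 t +
      (2 ^ (k + 1) * K + middleConst k r) * ENNReal.ofReal (t ^ k) * phiInt ϕ 1 (k + r) t 1 +
      startConst k r m * ENNReal.ofReal (t ^ k) * bestApprox (k + r) p f := by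
  rcases ht.1.eq_or_lt with rfl | ht0
  · rw [modulus_zero hk]
    exact zero_le
  obtain ⟨J, hJ1, hJ2⟩ := exists_nat_pow_near_of_lt_one ht0
    (ht.2.trans (by norm_num)) (by norm_num : (0 : ℝ) < 1 / 2) (by norm_num)
  have hJ : 1 ≤ J := by
    by_contra h0
    have : J = 0 := by omega
    rw [this] at hJ1
    norm_num at hJ1
    linarith [ht.2]
  obtain ⟨R, hR, hRf⟩ := exists_eLpNorm_sub_le_two_mul_bestApprox hp hf (k + r)
  have hD := diffConst_nonneg k r
  have hstart : eLpNorm (fun x => (P m - R).eval x) p mu ≤ 4 * bestApprox (k + r) p f := by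
    refine (eLpNorm_eval_sub_le hp hf _ _).trans ?_
    calc _ ≤ 2 * bestApprox (k + r) p f + 2 * bestApprox (k + r) p f :=
          add_le_add ((hP.near m).trans (mul_le_mul_right (bestApprox_anti hkr p f) _)) hRf
      _ = _ := by ring
  refine iSup₂_le fun h hh => ?_
  refine (diffNorm_le_telescope hp hk r hh.1 hF hP.mem hR hkr (le_max_left m (J + 2))).trans ?_
  calc _ ≤ 2 ^ (k + 1) *
          (K * (phiInt ϕ r r 0 t + ENNReal.ofReal (t ^ k) * phiInt ϕ 1 (k + r) t 1)) +
        middleConst k r * ENNReal.ofReal (t ^ k) * phiInt ϕ 1 (k + r) t 1 +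
        ENNReal.ofReal (diffConst k r * (t ^ k * (2 ^ m) ^ (k + r))) *
          (4 * bestApprox (k + r) p f) := by
        refine add_le_add (add_le_add (mul_le_mul_right (hrem J t hJ hJ1 hJ2) _)
          (sum_step_le hϕ hP k r hm hJ hh.1 hh.2 hJ2))
          (mul_le_mul' (ENNReal.ofReal_le_ofReal ?_) hstart)
        have h1 := hh.1
        have h2 := hh.2
        gcongr
    _ = 2 ^ (k + 1) * K * phiInt ϕ r r 0 t +
        (2 ^ (k + 1) * K + middleConst k r) * ENNReal.ofReal (t ^ k) * phiInt ϕ 1 (k + r) t 1 +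
        startConst k r m * ENNReal.ofReal (t ^ k) * bestApprox (k + r) p f := by
        rw [startConst, mul_left_comm (diffConst k r), ENNReal.ofReal_mul (pow_nonneg ht0.le k)]
        ring
    _ ≤ _ := by
        gcongr
        exact le_self_add

/-- The constant of `exists_memB_and_remainder_le`: the first summand serves `r ≥ 1`, the second
`r = 0`. -/
def remConst (k r : ℕ) : ℝ≥0∞ :=
  ENNReal.ofReal (r.factorial * (24 * 8 ^ r)) * 4 * 2 ^ (r + 1) + 2 * 2 ^ k * 2 ^ (k + 1)

theorem stepNorm_le {p : ℝ≥0∞} (hp : 1 ≤ p) {ϕ f : ℝ → ℝ} {m : ℕ} {P : ℕ → Polynomial ℝ}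
    (hP : IsNearBest p ϕ f m P) (i j : ℕ) :
    stepNorm p (fun j => P (m + j)) i j ≤
      ENNReal.ofReal (i.factorial * (24 * 8 ^ i)) * 4 * dyadTerm ϕ i (m + j) := by
  have hdeg : (P (m + j + 1) - P (m + j)).natDegree ≤ 2 ^ (m + j + 1) :=
    natDegree_le_of_mem_degreeLT (Submodule.sub_mem _ (hP.mem _)
      (Polynomial.degreeLT_mono (Nat.pow_le_pow_right two_pos (Nat.le_succ _)) (hP.mem _)))
  have h := eLpNorm_iterate_derivative_le hp _ (n := 2 ^ (m + j + 1)) Nat.one_le_two_pow hdeg i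
  refine h.trans ((mul_le_mul_right (hP.step _ (Nat.le_add_right m j)) _).trans (le_of_eq ?_))
  rw [dyadTerm_eq ϕ i (m + j)]
  have h2 : (i.factorial : ℝ) * (24 * (4 * ((2 ^ (m + j + 1) : ℕ) : ℝ)) ^ i) =
      i.factorial * (24 * 8 ^ i) * (2 ^ (m + j)) ^ i := by
    push_cast
    rw [show (4 : ℝ) * 2 ^ (m + j + 1) = 8 * 2 ^ (m + j) by ring, mul_pow]
    ring
  rw [h2, ENNReal.ofReal_mul (by positivity)]
  ring

/-- The representative `g` of `f` in `𝔹_p^r`, and the error with which `P_M^{(r)}` approximates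
`g^{(r)}` for `2^{-M}` at most comparable with `t`. For `r ≥ 1` the error is bounded by `∫_0^t`. For
`r = 0` that integral is `0`, and `ϕ(2^{-J})` is bounded by `t^k ∫_t^1` instead. -/
theorem exists_memB_and_remainder_le {p : ℝ≥0∞} (hp : 1 ≤ p) (k r : ℕ) {ϕ f : ℝ → ℝ}
    (hϕ : IsPhi ϕ) (hint : phiInt ϕ r r 0 1 < ∞) (hf : MemLp f p mu) {m : ℕ}
    {P : ℕ → Polynomial ℝ} (hP : IsNearBest p ϕ f m P) (hm : 1 ≤ m) :
    ∃ g : ℝ → ℝ, g =ᵐ[mu] f ∧ MemB p r g ∧ AEStronglyMeasurable (iteratedDeriv r g) mu ∧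
      ∀ (J : ℕ) (t : ℝ), 1 ≤ J → (1 / 2) ^ (J + 1) < t → t ≤ (1 / 2) ^ J →
      eLpNorm (fun x => (iteratedDeriv r g x -
        (Polynomial.derivative^[r] (P (max m (J + 2)))).eval x) * wphi x ^ r) p mu ≤
        remConst k r * (phiInt ϕ r r 0 t + ENNReal.ofReal (t ^ k) * phiInt ϕ 1 (k + r) t 1) := by
  rcases r with _ | s
  · refine ⟨f, EventuallyEq.rfl, hf, by rw [iteratedDeriv_zero]; exact hf.1, fun J t hJ h1 h2 => ?_⟩
    simp only [iteratedDeriv_zero, Function.iterate_zero, id_eq, pow_zero, mul_one, add_zero]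
    have ht0 : 0 < t := lt_trans (by positivity) h1
    refine (hP.near_phi _ (le_max_left _ _)).trans ?_
    have h3 : dyadTerm ϕ 0 (max m (J + 2)) ≤ dyadTerm ϕ 0 J := dyadTerm_zero_anti hϕ (by omega)
    have h4 : dyadTerm ϕ 0 J ≤ 2 ^ k * ENNReal.ofReal (t ^ k) * dyadTerm ϕ k J := by
      have e2 : (2 : ℝ≥0∞) ^ k = ENNReal.ofReal (2 ^ k) := by
        rw [ENNReal.ofReal_pow zero_le_two, ENNReal.ofReal_ofNat]
      rw [dyadTerm_eq ϕ k J, e2, ← ENNReal.ofReal_mul (by positivity), ← mul_assoc,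
        ← ENNReal.ofReal_mul (by positivity)]
      refine le_mul_of_one_le_left zero_le ?_
      rw [ENNReal.one_le_ofReal, ← mul_pow, ← mul_pow]
      refine one_le_pow₀ ?_
      have h5 : (1 / 2 : ℝ) ^ (J + 1) * 2 ^ (J + 1) = 1 := by rw [← mul_pow]; norm_num
      rw [pow_succ 2 J] at h5
      have h6 : (0 : ℝ) < 2 ^ J := by positivity
      nlinarith
    have h5 : dyadTerm ϕ k J ≤ 2 ^ (k + 1) * phiInt ϕ 1 k t 1 := by
      refine le_trans ?_ (sum_dyadTerm_le hϕ k h2)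
      have := Finset.single_le_sum (f := fun i => dyadTerm ϕ k (i + 1)) (fun _ _ => zero_le)
        (Finset.mem_range.2 (show J - 1 < J by omega))
      simpa only [Nat.sub_add_cancel hJ] using this
    calc 2 * dyadTerm ϕ 0 (max m (J + 2))
        ≤ 2 * (2 ^ k * ENNReal.ofReal (t ^ k) * (2 ^ (k + 1) * phiInt ϕ 1 k t 1)) :=
          mul_le_mul_right (h3.trans (h4.trans (mul_le_mul_right h5 _))) _
      _ = 2 * 2 ^ k * 2 ^ (k + 1) * (ENNReal.ofReal (t ^ k) * phiInt ϕ 1 k t 1) := by ring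
      _ ≤ _ := by
          refine mul_le_mul' ?_ le_add_self
          exact le_add_self
  · set r := s + 1 with hr
    have hr1 : (1 : ℝ) ≤ (r : ℝ) := by rw [hr]; push_cast; linarith [Nat.cast_nonneg (α := ℝ) s]
    have htail : ∀ M : ℕ, 1 ≤ M → ∀ t : ℝ, t ≤ 1 → (1 / 2) ^ (M - 1) ≤ t →
        ∑' j, dyadTerm ϕ r (M + j) ≤ 2 ^ (r + 1) * phiInt ϕ r r 0 t := by
      intro M hM t ht1 ht
      have h1 := tsum_dyadTerm_le hϕ r ht
      have h2 : ∀ j, M - 1 + j + 1 = M + j := fun j => by omega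
      simp only [h2] at h1
      exact h1.trans (mul_le_mul_right (phiInt_one_le hϕ hr1 r le_rfl ht1) _)
    set C : ℝ≥0∞ := ENNReal.ofReal (r.factorial * (24 * 8 ^ r)) * 4 with hC
    have hsum : ∀ i ≤ s + 1, ∑' j, stepNorm p (fun j => P (m + j)) i j ≠ ∞ := by
      intro i hi
      refine ne_top_of_le_ne_top ?_ (ENNReal.tsum_le_tsum fun j => (stepNorm_le hp hP i j).trans
        (mul_le_mul_right (dyadTerm_mono_exponent hϕ hi (m + j)) _))
      rw [ENNReal.tsum_mul_left]
      refine ENNReal.mul_ne_top (ENNReal.mul_ne_top ENNReal.ofReal_ne_top (by norm_num)) ?_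
      exact ne_top_of_le_ne_top (ENNReal.mul_ne_top (by simp) hint.ne)
        (htail m hm 1 le_rfl (half_pow_mem _).2)
    have hfP : Tendsto (fun j => eLpNorm (fun x => f x - (P (m + j)).eval x) p mu) atTop (𝓝 0) := by
      have h1 : Tendsto (fun j => 2 * dyadTerm ϕ 0 (m + j)) atTop (𝓝 0) := by
        have h2 := ENNReal.Tendsto.const_mul (a := 2) ((tendsto_dyadTerm_zero hϕ).comp
          (tendsto_add_atTop_nat m)) (Or.inr (by norm_num))
        rw [mul_zero] at h2
        simpa only [Function.comp_def, add_comm m] using h2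
      exact tendsto_of_tendsto_of_tendsto_of_le_of_le tendsto_const_nhds h1 (fun _ => zero_le)
        fun j => hP.near_phi _ (Nat.le_add_right m j)
    obtain ⟨g, hgf, hgB, hgm, hg⟩ := exists_memB_of_summable hp hf hfP hsum
    refine ⟨g, hgf, hgB, hgm, fun J t hJ h1 h2 => ?_⟩
    set M := max m (J + 2)
    have hmM : m ≤ M := le_max_left _ _
    have hJM : J + 2 ≤ M := le_max_right _ _
    have h3 := hg (M - m)
    rw [Nat.add_sub_cancel' hmM] at h3
    refine h3.trans ?_
    calc ∑' j, stepNorm p (fun j => P (m + j)) (s + 1) (M - m + j)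
        ≤ ∑' j, C * dyadTerm ϕ r (M + j) := by
          refine ENNReal.tsum_le_tsum fun j => ?_
          have := stepNorm_le hp hP (s + 1) (M - m + j)
          rwa [← add_assoc, Nat.add_sub_cancel' hmM] at this
      _ = C * ∑' j, dyadTerm ϕ r (M + j) := ENNReal.tsum_mul_left
      _ ≤ C * (2 ^ (r + 1) * phiInt ϕ r r 0 t) := by
          refine mul_le_mul_right (htail M (by omega) t (h2.trans (half_pow_mem J).2) ?_) _
          exact (pow_le_pow_of_le_one (by norm_num) (by norm_num)
            (by omega : J + 1 ≤ M - 1)).trans h1.le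
      _ = C * 2 ^ (r + 1) * phiInt ϕ r r 0 t := by ring
      _ ≤ _ := mul_le_mul' le_self_add le_self_add

/-- The condition `n ≥ 2` gives `ϕ(1/n) ≤ ϕ(1/2)`, and `ϕ(1/2)` is controlled by the integral over
`(1/2, 1]`. -/
theorem bestApprox_le_phiInt {p : ℝ≥0∞} {ϕ f : ℝ → ℝ} (hϕ : IsPhi ϕ) {n : ℕ} (hn : 2 ≤ n)
    (hE : bestApprox n p f ≤ ENNReal.ofReal (ϕ (1 / (n : ℝ)))) {t : ℝ} (ht : t ≤ 1 / 2) :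
    bestApprox n p f ≤ 2 ^ (n + 1) * phiInt ϕ 1 n t 1 := by
  have hn' : (2 : ℝ) ≤ n := by exact_mod_cast hn
  have h1 := sum_dyadTerm_le hϕ n (J := 1) (t := t) (by rwa [pow_one])
  rw [Finset.sum_range_one] at h1
  refine hE.trans (le_trans (ENNReal.ofReal_le_ofReal ?_) h1)
  rw [zero_add, pow_one, pow_one]
  have hm : (1 / 2 : ℝ) ∈ Icc (0 : ℝ) 1 := ⟨by norm_num, by norm_num⟩
  have h2 : ϕ (1 / n) ≤ ϕ (1 / 2) := by
    refine hϕ.mono ⟨by positivity, ?_⟩ hm ?_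
    · rw [div_le_one (by linarith)]; linarith
    · exact one_div_le_one_div_of_le two_pos hn'
  exact h2.trans (le_mul_of_one_le_left (hϕ.nonneg _ hm) (one_le_pow₀ one_le_two))

end InverseApprox

end

theorem theorem3p199 (p : ℝ≥0∞) (hp : 1 ≤ p) (k r : ℕ) (hk : 1 ≤ k) :
    ∃ (c : ℝ≥0) (cN : ℕ → ℝ≥0), ∀ (N : ℕ), 1 ≤ N →
      ∀ ϕ : ℝ → ℝ, InverseApprox.IsPhi ϕ →
      InverseApprox.phiInt ϕ r r 0 1 < ∞ →
      ∀ f : ℝ → ℝ, MemLp f p InverseApprox.mu →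
      (∀ n : ℕ, N ≤ n →
        InverseApprox.bestApprox n p f ≤ ENNReal.ofReal (ϕ (1 / (n : ℝ)))) →
      ∃ g : ℝ → ℝ, g =ᵐ[InverseApprox.mu] f ∧ InverseApprox.MemB p r g ∧
        (∀ t ∈ Icc (0 : ℝ) (1 / 2),
          InverseApprox.modulus k r p (iteratedDeriv r g) t ≤
            c * InverseApprox.phiInt ϕ r r 0 t
            + c * ENNReal.ofReal (t ^ k) * InverseApprox.phiInt ϕ 1 (k + r) t 1
            + cN N * ENNReal.ofReal (t ^ k) * InverseApprox.bestApprox (k + r) p f) ∧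
        (N ≤ k + r → 2 ≤ k + r → ∀ t ∈ Icc (0 : ℝ) (1 / 2),
          InverseApprox.modulus k r p (iteratedDeriv r g) t ≤
            c * InverseApprox.phiInt ϕ r r 0 t
            + c * ENNReal.ofReal (t ^ k) * InverseApprox.phiInt ϕ 1 (k + r) t 1) := by
  open InverseApprox in
  set A : ℝ≥0∞ := 2 ^ (k + 1) * remConst k r + middleConst k r with hA
  set B : ℝ≥0∞ := startConst k r (k + r) * 2 ^ (k + r + 1) with hB
  have hstart : ∀ m, startConst k r m ≠ ∞ := fun m =>
    ENNReal.mul_ne_top ENNReal.ofReal_ne_top (by norm_num)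
  have hAt : A ≠ ∞ := by
    rw [hA, remConst, middleConst]
    finiteness
  have hBt : B ≠ ∞ := ENNReal.mul_ne_top (hstart _) (by simp)
  refine ⟨(A + B).toNNReal, fun N => (startConst k r (max N (k + r))).toNNReal,
    fun N hN ϕ hϕ hint f hf hE => ?_⟩
  rw [ENNReal.coe_toNNReal (ENNReal.add_ne_top.2 ⟨hAt, hBt⟩), ENNReal.coe_toNNReal (hstart _)]
  -- The telescoping sum starts at `P m`: degree `2 ^ m` is past both `N` and `k + r`.
  set m := max N (k + r)
  have hpow : m ≤ 2 ^ m := Nat.lt_two_pow_self.le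
  obtain ⟨P, hP⟩ := exists_isNearBest hp hϕ hf hE ((le_max_left N (k + r)).trans hpow)
  have hm1 : 1 ≤ m := hN.trans (le_max_left _ _)
  obtain ⟨g, hgf, hgB, hgm, hrem⟩ := exists_memB_and_remainder_le hp k r hϕ hint hf hP hm1
  have hmain : ∀ t ∈ Icc (0 : ℝ) (1 / 2), modulus k r p (iteratedDeriv r g) t ≤
      A * phiInt ϕ r r 0 t + A * ENNReal.ofReal (t ^ k) * phiInt ϕ 1 (k + r) t 1 +
        startConst k r m * ENNReal.ofReal (t ^ k) * bestApprox (k + r) p f := fun t ht =>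
    modulus_le hp hk r hϕ hf hP hm1 ((le_max_right N (k + r)).trans hpow) hgm hrem ht
  have hAB : A ≤ A + B := le_self_add
  refine ⟨g, hgf, hgB, fun t ht => (hmain t ht).trans ?_,
    fun hNkr hkr t ht => (hmain t ht).trans ?_⟩
  · exact add_le_add (add_le_add (mul_le_mul' hAB le_rfl)
      (mul_le_mul' (mul_le_mul' hAB le_rfl) le_rfl)) le_rfl
  · have h1 := bestApprox_le_phiInt hϕ hkr (hE _ hNkr) ht.2
    have hmk : m = k + r := max_eq_right hNkr
    rw [hmk]
    calc _ ≤ A * phiInt ϕ r r 0 t + A * ENNReal.ofReal (t ^ k) * phiInt ϕ 1 (k + r) t 1 +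
          startConst k r (k + r) * ENNReal.ofReal (t ^ k) *
            (2 ^ (k + r + 1) * phiInt ϕ 1 (k + r) t 1) := add_le_add le_rfl (mul_le_mul' le_rfl h1)
      _ = A * phiInt ϕ r r 0 t +
          (A + B) * ENNReal.ofReal (t ^ k) * phiInt ϕ 1 (k + r) t 1 := by rw [hB]; ring
      _ ≤ _ := add_le_add (mul_le_mul' hAB le_rfl) le_rfl
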